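/- A non-deterministic timed automaton with silent transitions (eNTA) is a tuple $A=(Q,q_0,\Sigma\cup\{\epsilon\},C,T)$, where $Q$ (locations), $\Sigma$ (observable actions), $C$ (clocks) are finite sets, $q_0\in Q$, and $T$ is a finite set of transitions $(q,a,g,R,q')$ with $q,q'\in Q$, $a\in\Sigma\cup\{\epsilon\}$, $R\subseteq C$, and $g$ a finite conjunction of constraints $c\sim n$ with $c\in C$, $\sim\,\in\{<,\le,=,\ge,>\}$, $n\in\mathbb N_0$. A (finite) run starts in $q_0$ with all clocks equal to $0$, and alternates delays $d_i\in\mathbb R_{\ge 0}$, which advance all clocks by $d_i$, with transitions $\tau_i=(q_{i-1},a_i,g_i,R_i,q_i)\in T$ whose guard $g_i$ holds at that moment and which reset the clocks in $R_i$ to $0$. Its observable timed trace is obtained from $(t_1,a_1),\dots,(t_k,a_k)$, $t_i=d_1+\dots+d_i$, by deleting the pairs with $a_i=\epsilon$. Let $\mathfrak L(A)$ be the set of observable timed traces of all runs of $A$ and $\mathfrak L_1(A)$ the set of those of length at most $1$. Let $\mathfrak{TS}_1(A)\subseteq\mathbb R_{\ge0}\times\Sigma$ be the set of all $(t,a)$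 such that in some run of $A$ the first observable transition occurs at time $t$ and has action $a$. As inputs of algorithms, automata are given by finite lists in which locations, actions and clocks are named by natural numbers. For integers $t_{per},L>0$, say that $(t_{per},L)$ are period parameters for $A$ if for all real $t\ge t_{per}$ and all actions $a$: $(t,a)\in\mathfrak{TS}_1(A)$ if and only if $(t+L,a)\in\mathfrak{TS}_1(A)$. Theorem. (1) There are computable functions $A\mapsto t_{per}(A)$ and $A\mapsto L(A)$ such that $(t_{per}(A),L(A))$ are period parameters for $A$, for every eNTA $A$. (2) Let $A_1,A_2$ be eNTAs with period parameters $(t_{per_1},L_1)$ and $(t_{per_2},L_2)$, and put $t_{per}=\max(t_{per_1},t_{per_2})$, $L=\mathrm{lcm}(L_1,L_2)$. Then $\mathfrak L_1(A_1)\subseteq\mathfrak L_1(A_2)$ if and only if every $(t,a)\in\mathfrak{TS}_1(A_1)$ with $t<t_{per}+L$ belongs to $\mathfrak{TS}_1(A_2)$. (3) The $1$-bounded language inclusion problem is decidable: there is an algorithm that decides, given two eNTAs $A_1,A_2$, whether $\mathfrak L_1(A_1)\subseteq\mathfrak L_1(A_2)$. -/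

import Mathlib

open scoped NNReal

namespace TimedAutomata

/-- The comparison symbols `<, ≤, =, ≥, >` of clock constraints. -/
inductive Cmp where
  | lt | le | eq | ge | gt

/-- The meaning of a comparison symbol. -/
def Cmp.Holds : Cmp → ℝ≥0 → ℝ≥0 → Prop
  | .lt, x, y => x < y
  | .le, x, y => x ≤ y
  | .eq, x, y => x = y
  | .ge, x, y => x ≥ y
  | .gt, x, y => x > y

/-- A constraint `c ∼ n` with `c` a clock and `n` a natural number. -/
structure Constraint where
  clock : ℕ
  cmp : Cmp
  bound : ℕ

/-- A transition `(q, a, g, C_rst, q')`. The action `none` is the silent action `ε`, the action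
`some a` is the observable action `a`; the guard is the conjunction of the listed constraints;
the finite set of clocks to be reset is given by a list. -/
structure Transition where
  src : ℕ
  act : Option ℕ
  guard : List Constraint
  reset : List ℕ
  tgt : ℕ

/-- A non-deterministic timed automaton with silent transitions `(Q, q₀, Σ ∪ {ε}, C, T)`, as a
finite object: locations, observable actions and clocks are named by natural numbers, and the
finite sets `Q`, `Σ`, `C`, `T` are given by lists. -/
structure ENTA where
  locs : List ℕ
  init : ℕ
  actions : List ℕ
  clocks : List ℕ
  trans : List Transition
  init_mem : init ∈ locs
  src_mem : ∀ τ ∈ trans, τ.src ∈ locs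
  act_mem : ∀ τ ∈ trans, ∀ a, τ.act = some a → a ∈ actions
  guard_mem : ∀ τ ∈ trans, ∀ g ∈ τ.guard, g.clock ∈ clocks
  reset_mem : ∀ τ ∈ trans, ∀ c ∈ τ.reset, c ∈ clocks
  tgt_mem : ∀ τ ∈ trans, τ.tgt ∈ locs

/-! ### Semantics -/

/-- Clock valuations. (Only the values on the clocks of the automaton at hand are ever read.) -/
abbrev Valuation := ℕ → ℝ≥0

/-- The valuation `v + d`. -/
def Valuation.delay (v : Valuation) (d : ℝ≥0) : Valuation := fun c => v c + d

/-- The valuation `v[R]`: the clocks in `R` are set to `0`. -/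
def Valuation.reset (v : Valuation) (R : List ℕ) : Valuation := fun c => if c ∈ R then 0 else v c

/-- `v ⊨ g`, for a guard `g`. -/
def Valuation.Sat (v : Valuation) (g : List Constraint) : Prop :=
  ∀ k ∈ g, k.cmp.Holds (v k.clock) k.bound

/-- `A.IsRunFrom q v [(d₁, τ₁), …, (dₖ, τₖ)]`: starting in the state `(q, v)`, the automaton can
let time `d₁` elapse, take transition `τ₁`, let time `d₂` elapse, take transition `τ₂`, etc. -/
def ENTA.IsRunFrom (A : ENTA) : ℕ → Valuation → List (ℝ≥0 × Transition) → Prop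
  | _, _, [] => True
  | q, v, (d, τ) :: ρ =>
      τ ∈ A.trans ∧ τ.src = q ∧ (v.delay d).Sat τ.guard ∧
        A.IsRunFrom τ.tgt ((v.delay d).reset τ.reset) ρ

/-- Finite runs: they start at the initial location with all clocks equal to `0`. -/
def ENTA.IsRun (A : ENTA) (ρ : List (ℝ≥0 × Transition)) : Prop :=
  A.IsRunFrom A.init (fun _ => 0) ρ

/-- The timed trace `(t₁, a₁), …, (tₖ, aₖ)` with `tᵢ = t + d₁ + ⋯ + dᵢ`, of a run that starts at
time `t`. -/
def timedTrace : ℝ≥0 → List (ℝ≥0 × Transition) → List (ℝ≥0 × Option ℕ)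
  | _, [] => []
  | t, (d, τ) :: ρ => (t + d, τ.act) :: timedTrace (t + d) ρ

/-- The observable part of a timed trace: the pairs with a silent action are deleted. -/
def observablePart (l : List (ℝ≥0 × Option ℕ)) : List (ℝ≥0 × ℕ) :=
  l.filterMap fun p => p.2.map fun a => (p.1, a)

/-- The language of `A`: the set of observable timed traces of the finite runs of `A`. -/
def ENTA.language (A : ENTA) : Set (List (ℝ≥0 × ℕ)) :=
  {w | ∃ ρ, A.IsRun ρ ∧ observablePart (timedTrace 0 ρ) = w}

/-- The observable timed traces of length at most `k`. -/
def ENTA.boundedLanguage (A : ENTA) (k : ℕ) : Set (List (ℝ≥0 × ℕ)) :=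
  {w | w ∈ A.language ∧ w.length ≤ k}

/-- The timestamp of the first observable event: all pairs `(t, a)` such that in some run of `A`
the first observable transition occurs at time `t` and has action `a`. -/
def ENTA.firstTimestamp (A : ENTA) : Set (ℝ≥0 × ℕ) :=
  {p | ∃ w, p :: w ∈ A.language}

/-- From time `tper` on, the first-event timestamp of `A` is periodic with period `L`. -/
def ENTA.IsPeriodic (A : ENTA) (tper L : ℕ) : Prop :=
  0 < tper ∧ 0 < L ∧ ∀ (t : ℝ≥0) (a : ℕ), (tper : ℝ≥0) ≤ t →
    ((t, a) ∈ A.firstTimestamp ↔ (t + L, a) ∈ A.firstTimestamp)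

/-! ### The effective encoding of automata, as inputs of algorithms -/

/-- Numbering of the comparison symbols. -/
def Cmp.equivFin : Cmp ≃ Fin 5 where
  toFun
    | .lt => 0
    | .le => 1
    | .eq => 2
    | .ge => 3
    | .gt => 4
  invFun
    | 0 => .lt
    | 1 => .le
    | 2 => .eq
    | 3 => .ge
    | 4 => .gt
  left_inv c := by cases c <;> rfl
  right_inv i := by fin_cases i <;> rfl

instance : Primcodable Cmp := Primcodable.ofEquiv (Fin 5) Cmp.equivFin

/-- A constraint as a tuple. -/
def Constraint.equivProd : Constraint ≃ ℕ × Cmp × ℕ where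
  toFun k := (k.clock, k.cmp, k.bound)
  invFun p := ⟨p.1, p.2.1, p.2.2⟩
  left_inv _ := rfl
  right_inv _ := rfl

instance : Primcodable Constraint := Primcodable.ofEquiv (ℕ × Cmp × ℕ) Constraint.equivProd

/-- A transition as a tuple. -/
def Transition.equivProd :
    Transition ≃ ℕ × Option ℕ × List Constraint × List ℕ × ℕ where
  toFun τ := (τ.src, τ.act, τ.guard, τ.reset, τ.tgt)
  invFun p := ⟨p.1, p.2.1, p.2.2.1, p.2.2.2.1, p.2.2.2.2⟩
  left_inv _ := rfl
  right_inv _ := rfl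

instance : Primcodable Transition :=
  Primcodable.ofEquiv (ℕ × Option ℕ × List Constraint × List ℕ × ℕ) Transition.equivProd

/-- Raw tuples `(Q, q₀, Σ, C, T)`. -/
abbrev RawENTA := List ℕ × ℕ × List ℕ × List ℕ × List Transition

/-- The well-formedness conditions of an automaton, on raw tuples. -/
def RawENTA.WF (x : RawENTA) : Prop :=
  x.2.1 ∈ x.1 ∧ ∀ τ ∈ x.2.2.2.2,
    τ.src ∈ x.1 ∧ (∀ a ∈ τ.act.toList, a ∈ x.2.2.1) ∧ (∀ g ∈ τ.guard, g.clock ∈ x.2.2.2.1) ∧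
      (∀ c ∈ τ.reset, c ∈ x.2.2.2.1) ∧ τ.tgt ∈ x.1

instance : DecidablePred RawENTA.WF := fun x => by
  unfold RawENTA.WF
  infer_instance

theorem primrecRel_mem : PrimrecRel fun (a : ℕ) (l : List ℕ) => a ∈ l :=
  ((PrimrecRel.exists_mem_list (R := fun a b : ℕ => a = b) Primrec.eq).comp
    Primrec.snd Primrec.fst).of_eq fun p => by simp

theorem primrec_constraint_clock : Primrec Constraint.clock :=
  Primrec.fst.comp (Primrec.of_equiv (e := Constraint.equivProd))

theorem primrec_transition_equiv : Primrec Transition.equivProd :=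
  Primrec.of_equiv (e := Transition.equivProd)

theorem primrecPred_forall_mem {α β : Type} [Primcodable α] [Primcodable β]
    {f : α → List β} {r : β → α → Prop} (hf : Primrec f) (hr : PrimrecRel r) :
    PrimrecPred fun a => ∀ b ∈ f a, r b a :=
  (PrimrecRel.forall_mem_list hr).comp hf Primrec.id

/-- Well-formedness is a primitive recursive property of raw tuples. -/
theorem primrecPred_wf : PrimrecPred RawENTA.WF := by
  have hT : Primrec fun p : Transition × RawENTA => Transition.equivProd p.1 :=
    primrec_transition_equiv.comp Primrec.fst
  have hsrc : Primrec fun p : Transition × RawENTA => p.1.src := Primrec.fst.comp hT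
  have hact : Primrec fun p : Transition × RawENTA => p.1.act :=
    Primrec.fst.comp (Primrec.snd.comp hT)
  have hactl : Primrec fun p : Transition × RawENTA => p.1.act.toList :=
    (Primrec.option_casesOn hact (Primrec.const ([] : List ℕ))
      (Primrec.list_cons.comp Primrec.snd (Primrec.const [])).to₂).of_eq
      fun p => by cases h : p.1.act <;> simp
  have hguard : Primrec fun p : Transition × RawENTA => p.1.guard :=
    Primrec.fst.comp (Primrec.snd.comp (Primrec.snd.comp hT))
  have hreset : Primrec fun p : Transition × RawENTA => p.1.reset :=
    Primrec.fst.comp (Primrec.snd.comp (Primrec.snd.comp (Primrec.snd.comp hT)))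
  have htgt : Primrec fun p : Transition × RawENTA => p.1.tgt :=
    Primrec.snd.comp (Primrec.snd.comp (Primrec.snd.comp (Primrec.snd.comp hT)))
  have hlocs : Primrec fun x : RawENTA => x.1 := Primrec.fst
  have hinit : Primrec fun x : RawENTA => x.2.1 := Primrec.fst.comp Primrec.snd
  have hacts : Primrec fun x : RawENTA => x.2.2.1 :=
    Primrec.fst.comp (Primrec.snd.comp Primrec.snd)
  have hclocks : Primrec fun x : RawENTA => x.2.2.2.1 :=
    Primrec.fst.comp (Primrec.snd.comp (Primrec.snd.comp Primrec.snd))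
  have htrans : Primrec fun x : RawENTA => x.2.2.2.2 :=
    Primrec.snd.comp (Primrec.snd.comp (Primrec.snd.comp Primrec.snd))
  have h1 : PrimrecPred fun p : Transition × RawENTA => p.1.src ∈ p.2.1 :=
    primrecRel_mem.comp hsrc (hlocs.comp Primrec.snd)
  have h2 : PrimrecPred fun p : Transition × RawENTA => ∀ a ∈ p.1.act.toList, a ∈ p.2.2.2.1 :=
    primrecPred_forall_mem (r := fun (a : ℕ) (p : Transition × RawENTA) => a ∈ p.2.2.2.1) hactl
      (primrecRel_mem.comp Primrec.fst (hacts.comp (Primrec.snd.comp Primrec.snd)))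
  have h3 : PrimrecPred fun p : Transition × RawENTA =>
      ∀ g ∈ p.1.guard, g.clock ∈ p.2.2.2.2.1 :=
    primrecPred_forall_mem
      (r := fun (g : Constraint) (p : Transition × RawENTA) => g.clock ∈ p.2.2.2.2.1) hguard
      (primrecRel_mem.comp (primrec_constraint_clock.comp Primrec.fst)
        (hclocks.comp (Primrec.snd.comp Primrec.snd)))
  have h4 : PrimrecPred fun p : Transition × RawENTA => ∀ c ∈ p.1.reset, c ∈ p.2.2.2.2.1 :=
    primrecPred_forall_mem
      (r := fun (c : ℕ) (p : Transition × RawENTA) => c ∈ p.2.2.2.2.1) hreset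
      (primrecRel_mem.comp Primrec.fst (hclocks.comp (Primrec.snd.comp Primrec.snd)))
  have h5 : PrimrecPred fun p : Transition × RawENTA => p.1.tgt ∈ p.2.1 :=
    primrecRel_mem.comp htgt (hlocs.comp Primrec.snd)
  have h6 : PrimrecPred fun x : RawENTA => x.2.1 ∈ x.1 := primrecRel_mem.comp hinit hlocs
  exact h6.and (primrecPred_forall_mem htrans (h1.and (h2.and (h3.and (h4.and h5)))))

/-- An automaton as a well-formed raw tuple. -/
def ENTA.equivSubtype : ENTA ≃ {x : RawENTA // RawENTA.WF x} where
  toFun A := ⟨(A.locs, A.init, A.actions, A.clocks, A.trans), A.init_mem, fun τ hτ =>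
    ⟨A.src_mem τ hτ, fun a ha => A.act_mem τ hτ a (by simpa using ha), A.guard_mem τ hτ,
      A.reset_mem τ hτ, A.tgt_mem τ hτ⟩⟩
  invFun x :=
    { locs := x.1.1
      init := x.1.2.1
      actions := x.1.2.2.1
      clocks := x.1.2.2.2.1
      trans := x.1.2.2.2.2
      init_mem := x.2.1
      src_mem := fun τ hτ => (x.2.2 τ hτ).1
      act_mem := fun τ hτ a ha => (x.2.2 τ hτ).2.1 a (by simp [ha])
      guard_mem := fun τ hτ => (x.2.2 τ hτ).2.2.1
      reset_mem := fun τ hτ => (x.2.2 τ hτ).2.2.2.1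
      tgt_mem := fun τ hτ => (x.2.2 τ hτ).2.2.2.2 }
  left_inv _ := rfl
  right_inv _ := rfl

instance : Primcodable {x : RawENTA // RawENTA.WF x} := Primcodable.subtype primrecPred_wf

instance : Primcodable ENTA :=
  Primcodable.ofEquiv {x : RawENTA // RawENTA.WF x} ENTA.equivSubtype

end TimedAutomata

open scoped NNReal

namespace TimedAutomata

/-! ### Families of reals with the same integer difference constraints -/

/-! A run may be stopped right after its first observable event, and the empty trace always belongs
to the language. So inclusion of the 1-bounded languages is inclusion of the sets of first events
(`ENTA.boundedLanguage_one_subset_iff`), and only silent runs followed by one observable transition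
need study.

The main tool is the region construction with an auxiliary clock that is never reset. Two states are
similar when their clock values (capped above a bound `e` for all constants), the number `0` and the
auxiliary clock satisfy the same strict integer difference constraints. Similar states can follow
each other's silent runs (`Similar.delay`, `ENTA.Reach.transfer`). If the auxiliary clock starts at
`-t`, it shows `0` at an event at time `t`; hence whether `(t, a)` is a first event depends only on
the integer, or the open unit interval between integers, in which `t` lies
(`ENTA.Observes.of_sameUnit`).

Periodicity: the set of pairs (location, region) silently reachable at time `n + 1` is a function of
the set for time `n` (`ENTA.silentRegions_succ`). This sequence is an orbit in a finite set of size
`P`, so it has period `P!` from index `P` on, and first events inherit this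
(`ENTA.BoundedBy.isPeriodic`). The code of an automaton is a computable choice of `e`. With two
periodic sets, times are reduced modulo the least common multiple of the periods
(`ENTA.firstTimestamp_subset_iff`).

Decidability: by the above, finitely many times `k / 2` have to be tested. For each of them a
pigeonhole argument bounds the number of silent transitions (`ENTA.Observes.exists_lt_bound`), and
replacing fractional parts by their ranks moves the run to a grid of mesh `1 / D`
(`ENTA.Observes.exists_isHist`). What remains is a finite, primitive recursive search. -/

/-- Two families of reals satisfy the same strict difference constraints with integer bounds. -/
def Compat {ι : Type*} (f g : ι → ℝ) : Prop :=
  ∀ i j (n : ℤ), f i < f j + n ↔ g i < g j + n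

/-- Difference constraints do not see a common translation, and an integer shift made on both sides
is absorbed in the bound `n`. Resets, delays and integer shifts of the auxiliary clock are all
instances. -/
theorem Compat.of_shift {ι κ : Type*} {f g : ι → ℝ} {f' g' : κ → ℝ} (h : Compat f g) (x y : ℝ)
    (hs : ∀ k, ∃ i, ∃ m : ℤ, f' k = f i + x + m ∧ g' k = g i + y + m) : Compat f' g' := by
  intro k l n
  obtain ⟨i, m, h1, h2⟩ := hs k
  obtain ⟨j, m', h3, h4⟩ := hs l
  have := h i j (m' + n - m)
  push_cast at this
  rw [h1, h2, h3, h4]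
  constructor
  · intro hlt
    have := this.1 (by linarith)
    linarith
  · intro hlt
    have := this.2 (by linarith)
    linarith

/-- The one-point extension step of a back-and-forth argument. If `x` is an integer translate of
some `f i`, then `y` is forced. Otherwise only the nearest translates of each `f i` around `x`
matter; compatibility puts the corresponding lower bounds for `y` below the upper ones, and density
yields `y`. -/
theorem Compat.exists_extend {ι : Type*} [Finite ι] {f g : ι → ℝ} (h : Compat f g) (x : ℝ) :
    ∃ y, Compat (fun o : Option ι => o.elim x f) (fun o : Option ι => o.elim y g) := by
  classical
  cases nonempty_fintype ι
  by_cases h0 : ∃ i, ∃ n : ℤ, x = f i + n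
  · obtain ⟨i, n, rfl⟩ := h0
    refine ⟨g i + n, h.of_shift 0 0 ?_⟩
    rintro (_ | j)
    · exact ⟨i, n, by simp, by simp⟩
    · exact ⟨j, 0, by simp, by simp⟩
  · push Not at h0
    obtain ⟨y, hlo, hhi⟩ := Order.exists_between_finsets
      (Finset.univ.image fun i => g i + (⌊x - f i⌋ : ℝ))
      (Finset.univ.image fun i => g i + ((⌊x - f i⌋ + 1 : ℤ) : ℝ)) (by
        simp only [Finset.mem_image, Finset.mem_univ, true_and, forall_exists_index,
          forall_apply_eq_imp_iff]
        intro i j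
        have h1 : f i + (⌊x - f i⌋ : ℝ) ≤ x := by linarith [Int.floor_le (x - f i)]
        have h2 : x < f j + (⌊x - f j⌋ + 1 : ℝ) := by linarith [Int.lt_floor_add_one (x - f j)]
        have := (h i j (⌊x - f j⌋ + 1 - ⌊x - f i⌋)).1 (by push_cast; linarith)
        push_cast at this ⊢
        linarith)
    simp only [Finset.mem_image, Finset.mem_univ, true_and, forall_exists_index,
      forall_apply_eq_imp_iff] at hlo hhi
    have key1 : ∀ i (n : ℤ), f i + n < x → g i + n < y := by
      intro i n hn
      have : n ≤ ⌊x - f i⌋ := Int.le_floor.2 (by linarith)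
      have : (n : ℝ) ≤ ⌊x - f i⌋ := by exact_mod_cast this
      linarith [hlo i]
    have key2 : ∀ i (n : ℤ), x < f i + n → y < g i + n := by
      intro i n hn
      have : ⌊x - f i⌋ < n := Int.floor_lt.2 (by linarith)
      have : ((⌊x - f i⌋ + 1 : ℤ) : ℝ) ≤ n := by exact_mod_cast this
      linarith [hhi i]
    refine ⟨y, ?_⟩
    rintro (_ | i) (_ | j) n
    · simp
    · simp only [Option.elim]
      refine ⟨key2 j n, fun hy => ?_⟩
      rcases lt_trichotomy x (f j + n) with h1 | h1 | h1
      · exact h1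
      · exact absurd h1 (h0 j n)
      · linarith [key1 j n h1]
    · simp only [Option.elim]
      constructor
      · intro hx
        have := key1 i (-n) (by push_cast; linarith)
        push_cast at this
        linarith
      · intro hy
        rcases lt_trichotomy x (f i + (-n : ℤ)) with h1 | h1 | h1
        · have := key2 i (-n) h1
          push_cast at this
          linarith
        · exact absurd h1 (h0 i (-n))
        · push_cast at h1
          linarith
    · exact h i j n

/-! ### Similar clock valuations -/

/-- The values of an auxiliary clock, of the present moment and of the clocks `c ≤ e`, where values
above `e` are replaced by `e + 1`. -/
noncomputable def clockPoint (e : ℕ) (v : Valuation) (u : ℝ) : Option (Option (Fin (e + 1))) → ℝ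
  | none => u
  | some none => 0
  | some (some c) => if v c ≤ e then v c else e + 1

/-- The valuations `v` and `w`, with auxiliary clocks `u` and `s`, lie in the same region. -/
def Similar (e : ℕ) (v : Valuation) (u : ℝ) (w : Valuation) (s : ℝ) : Prop :=
  Compat (clockPoint e v u) (clockPoint e w s)

theorem clockPoint_clock {e : ℕ} {v : Valuation} {u : ℝ} (c : Fin (e + 1)) :
    (v c ≤ e ∧ clockPoint e v u (some (some c)) = v c) ∨
      ((e : ℝ) < v c ∧ clockPoint e v u (some (some c)) = e + 1) := by
  simp only [clockPoint]
  split_ifs with h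
  · exact Or.inl ⟨h, rfl⟩
  · exact Or.inr ⟨by exact_mod_cast not_le.1 h, rfl⟩

/-- Capping at `e + 1` is invisible to comparisons with constants up to `e`. -/
theorem clockPoint_lt_iff {e : ℕ} {v : Valuation} {u : ℝ} (c : Fin (e + 1)) {n : ℕ} (hn : n ≤ e) :
    ((v c : ℝ) < n ↔ clockPoint e v u (some (some c)) < n) ∧
      ((n : ℝ) < v c ↔ (n : ℝ) < clockPoint e v u (some (some c))) := by
  have hn' : (n : ℝ) ≤ e := by exact_mod_cast hn
  rcases clockPoint_clock (v := v) (u := u) c with ⟨_, h⟩ | ⟨h1, h⟩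
  · simp [h]
  · rw [h]
    constructor <;> constructor <;> intro <;> linarith

/-- The entry `0` at index `some none` turns a comparison with a constant into a difference
constraint. -/
theorem Similar.lt_iff {e : ℕ} {v w : Valuation} {u s : ℝ} (h : Similar e v u w s) {c n : ℕ}
    (hc : c ≤ e) (hn : n ≤ e) : (v c < n ↔ w c < n) ∧ ((n : ℝ≥0) < v c ↔ (n : ℝ≥0) < w c) := by
  have h1 := clockPoint_lt_iff (v := v) (u := u) ⟨c, Nat.lt_succ_of_le hc⟩ hn
  have h2 := clockPoint_lt_iff (v := w) (u := s) ⟨c, Nat.lt_succ_of_le hc⟩ hn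
  have h3 := h (some (some ⟨c, Nat.lt_succ_of_le hc⟩)) (some none) n
  have h4 := h (some none) (some (some ⟨c, Nat.lt_succ_of_le hc⟩)) (-n)
  have e1 : ∀ (v : Valuation) (u : ℝ), clockPoint e v u (some none) = 0 := fun _ _ => rfl
  simp only [e1] at h3 h4
  push_cast at h3 h4
  simp only [zero_add, ← sub_eq_add_neg, sub_pos] at h3 h4
  constructor
  · rw [← NNReal.coe_lt_coe, ← NNReal.coe_lt_coe, NNReal.coe_natCast]
    exact h1.1.trans (h3.trans h2.1.symm)
  · rw [← NNReal.coe_lt_coe, ← NNReal.coe_lt_coe, NNReal.coe_natCast]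
    exact h1.2.trans (h4.trans h2.2.symm)

theorem Cmp.holds_congr {x y n m : ℝ≥0} (h1 : x < n ↔ y < m) (h2 : n < x ↔ m < y) (c : Cmp) :
    c.Holds x n ↔ c.Holds y m := by
  cases c
  · exact h1
  · simpa [Cmp.Holds] using not_congr h2
  · simp only [Cmp.Holds]
    rw [le_antisymm_iff, le_antisymm_iff, ← not_lt, ← not_lt, ← not_lt, ← not_lt, h1, h2]
  · simpa [Cmp.Holds] using not_congr h1
  · exact h2

theorem Similar.sat_iff {e : ℕ} {v w : Valuation} {u s : ℝ} (h : Similar e v u w s)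
    {g : List Constraint} (hg : ∀ k ∈ g, k.clock ≤ e ∧ k.bound ≤ e) : v.Sat g ↔ w.Sat g := by
  refine forall₂_congr fun k hk => ?_
  have := h.lt_iff (hg k hk).1 (hg k hk).2
  exact Cmp.holds_congr this.1 this.2 _

theorem Similar.reset {e : ℕ} {v w : Valuation} {u s : ℝ} (h : Similar e v u w s) (R : List ℕ) :
    Similar e (v.reset R) u (w.reset R) s := by
  refine Compat.of_shift h 0 0 ?_
  rintro (_ | _ | c)
  · exact ⟨none, 0, by simp [clockPoint]⟩
  · exact ⟨some none, 0, by simp [clockPoint]⟩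
  · by_cases hc : (c : ℕ) ∈ R
    · exact ⟨some none, 0, by simp [clockPoint, Valuation.reset, hc]⟩
    · exact ⟨some (some c), 0, by simp [clockPoint, Valuation.reset, hc]⟩

/-- Delaying by `d` amounts to moving the origin to `-d`. So `-d` is adjoined to the family, a
matching `y` is found on the other side, and both families are translated until the new points
become `0`. The matching delay is `-y`. -/
theorem Similar.delay {e : ℕ} {v w : Valuation} {u s : ℝ} (h : Similar e v u w s) (d : ℝ≥0) :
    ∃ d' : ℝ≥0, Similar e (v.delay d) (u + d) (w.delay d') (s + d') := by
  obtain ⟨y, hy⟩ := Compat.exists_extend h (-d)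
  have hy0 : 0 ≤ -y := by
    have := hy (some (some none)) none 0
    simp only [Option.elim, clockPoint] at this
    by_contra hlt
    have := this.2 (by push_cast; linarith)
    have := d.2
    push_cast at *
    linarith
  obtain ⟨d', hd'⟩ : ∃ d' : ℝ≥0, (d' : ℝ) = -y := ⟨(-y).toNNReal, Real.coe_toNNReal _ hy0⟩
  refine ⟨d', Compat.of_shift hy d (-y) ?_⟩
  rintro (_ | _ | c)
  · exact ⟨some none, 0, by simp [clockPoint, hd']⟩
  · exact ⟨none, 0, by simp [clockPoint]⟩
  -- Both sides must agree on which clocks pass the cap during the delay; this is the constraint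
  -- with bound `-e` between the new origin and the clock.
  · have hiff : v.delay d c ≤ e ↔ w.delay d' c ≤ e := by
      have h1 := hy none (some (some (some c))) (-e)
      simp only [Option.elim] at h1
      push_cast at h1
      simp only [Valuation.delay, ← NNReal.coe_le_coe]
      push_cast
      rw [hd']
      rcases clockPoint_clock (v := v) (u := u) c with ⟨a1, a2⟩ | ⟨a1, a2⟩ <;>
      rcases clockPoint_clock (v := w) (u := s) c with ⟨b1, b2⟩ | ⟨b1, b2⟩
      · rw [a2, b2] at h1
        rw [← not_lt, ← not_lt]
        refine not_congr ⟨fun hh => ?_, fun hh => ?_⟩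
        · linarith [h1.1 (by linarith)]
        · linarith [h1.2 (by linarith)]
      · exact absurd ((h.lt_iff (Nat.le_of_lt_succ c.2) le_rfl).2.2 (by exact_mod_cast b1))
          (not_lt.2 a1)
      · exact absurd ((h.lt_iff (Nat.le_of_lt_succ c.2) le_rfl).2.1 (by exact_mod_cast a1))
          (not_lt.2 b1)
      · have := d.2
        constructor <;> intro <;> linarith
    by_cases hc : v.delay d c ≤ e
    · have hc' := hiff.1 hc
      refine ⟨some (some (some c)), 0, ?_⟩
      have g1 : v c ≤ e := le_trans le_self_add hc
      have g2 : w c ≤ e := le_trans le_self_add hc'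
      simp only [clockPoint, hc, hc', Option.elim, g1, g2, if_true]
      simp [Valuation.delay, hd']
    · have hc' := mt hiff.2 hc
      -- A capped clock is the new origin plus the integer `e + 1`.
      refine ⟨none, e + 1, ?_⟩
      simp only [clockPoint, hc, hc', Option.elim, if_false]
      simp

/-! ### Silent reachability -/

/-- `A.Reach q v m t q' v'`: from the state `(q, v)` the automaton can get to the state `(q', v')`
in time `t` with `m` silent transitions and delays. -/
inductive ENTA.Reach (A : ENTA) (q : ℕ) (v : Valuation) : ℕ → ℝ≥0 → ℕ → Valuation → Prop
  | refl : A.Reach q v 0 0 q v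
  | delay {m t q' v'} (d : ℝ≥0) : A.Reach q v m t q' v' → A.Reach q v m (t + d) q' (v'.delay d)
  | silent {m t v' τ} : A.Reach q v m t τ.src v' → τ ∈ A.trans → τ.act = none → v'.Sat τ.guard →
      A.Reach q v (m + 1) t τ.tgt (v'.reset τ.reset)

theorem Valuation.delay_zero (v : Valuation) : v.delay 0 = v := by
  funext c; simp [Valuation.delay]

theorem Valuation.delay_delay (v : Valuation) (d d' : ℝ≥0) :
    (v.delay d).delay d' = v.delay (d + d') := by
  funext c; simp [Valuation.delay, add_assoc]

theorem ENTA.Reach.trans {A : ENTA} {q q' q'' m m' t t'} {v v' v'' : Valuation}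
    (h : A.Reach q v m t q' v') (h' : A.Reach q' v' m' t' q'' v'') :
    A.Reach q v (m + m') (t + t') q'' v'' := by
  induction h' with
  | refl => simpa using h
  | delay d _ ih => rw [← add_assoc]; exact ih.delay d
  | silent _ h1 h2 h3 ih => rw [← add_assoc]; exact ih.silent h1 h2 h3

/-- The cut is made immediately after the `m`-th silent transition, with all later delays left to
the second half. -/
theorem ENTA.Reach.split_count {A : ENTA} {q q' M t} {v v' : Valuation}
    (h : A.Reach q v M t q' v') (m : ℕ) (hm : m ≤ M) :
    ∃ t₁ t₂ q₁ v₁, t₁ + t₂ = t ∧ A.Reach q v m t₁ q₁ v₁ ∧ A.Reach q₁ v₁ (M - m) t₂ q' v' := by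
  induction h with
  | refl =>
    obtain rfl := Nat.le_zero.1 hm
    exact ⟨0, 0, _, _, by simp, .refl, .refl⟩
  | delay d _ ih =>
    obtain ⟨t₁, t₂, q₁, v₁, ht, h1, h2⟩ := ih hm
    exact ⟨t₁, t₂ + d, q₁, v₁, by rw [← ht, add_assoc], h1, h2.delay d⟩
  | @silent M t _ _ h0 h1 h2 h3 ih =>
    rcases hm.lt_or_eq with hlt | rfl
    · obtain ⟨t₁, t₂, q₁, v₁, ht, g1, g2⟩ := ih (Nat.le_of_lt_succ hlt)
      refine ⟨t₁, t₂, q₁, v₁, ht, g1, ?_⟩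
      rw [Nat.succ_sub (Nat.le_of_lt_succ hlt)]
      exact g2.silent h1 h2 h3
    · exact ⟨t, 0, _, _, by simp, h0.silent h1 h2 h3, by simpa using .refl⟩

theorem ENTA.Reach.split_time {A : ENTA} {q q' M T} {v v' : Valuation}
    (h : A.Reach q v M T q' v') (t : ℝ≥0) (ht : t ≤ T) :
    ∃ m₁ m₂ q₁ v₁, A.Reach q v m₁ t q₁ v₁ ∧ A.Reach q₁ v₁ m₂ (T - t) q' v' := by
  induction h with
  | refl =>
    obtain rfl := le_antisymm ht zero_le
    exact ⟨0, 0, _, _, .refl, by simpa using .refl⟩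
  | @delay m T q' v' d h0 ih =>
    rcases le_total t T with hle | hle
    · obtain ⟨m₁, m₂, q₁, v₁, h1, h2⟩ := ih hle
      refine ⟨m₁, m₂, q₁, v₁, h1, ?_⟩
      rw [add_comm T d, add_tsub_assoc_of_le hle, add_comm]
      exact h2.delay d
    -- The last delay straddles `t` and is itself cut in two.
    · refine ⟨m, 0, q', v'.delay (t - T), ?_, ?_⟩
      · have := h0.delay (t - T)
        rwa [add_tsub_cancel_of_le hle] at this
      · have := (ENTA.Reach.refl (A := A) (q := q') (v := v'.delay (t - T))).delay (T + d - t)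
        rwa [Valuation.delay_delay, zero_add, show t - T + (T + d - t) = d from ?_] at this
        rw [← NNReal.coe_inj]
        rw [NNReal.coe_add, NNReal.coe_sub hle, NNReal.coe_sub ht, NNReal.coe_add]
        ring
  | @silent M t _ _ h0 h1 h2 h3 ih =>
    obtain ⟨m₁, m₂, q₁, v₁, g1, g2⟩ := ih ht
    exact ⟨m₁, m₂ + 1, q₁, v₁, g1, g2.silent h1 h2 h3⟩

/-- All locations, and all clocks and constants in guards, of `A` are at most `e`. -/
structure ENTA.BoundedBy (A : ENTA) (e : ℕ) : Prop where
  init_le : A.init ≤ e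
  tgt_le : ∀ τ ∈ A.trans, τ.tgt ≤ e
  guard_le : ∀ τ ∈ A.trans, ∀ k ∈ τ.guard, k.clock ≤ e ∧ k.bound ≤ e

theorem ENTA.Reach.loc_le {A : ENTA} {e q q' m t} {v v' : Valuation} (hA : A.BoundedBy e)
    (h : A.Reach q v m t q' v') (hq : q ≤ e) : q' ≤ e := by
  induction h with
  | refl => exact hq
  | delay _ _ ih => exact ih
  | silent _ h1 _ _ _ => exact hA.tgt_le _ h1

/-- The second run takes the same transitions with adapted delays. The auxiliary clock is never
reset, so it compares the total durations of the two runs. -/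
theorem ENTA.Reach.transfer {A : ENTA} {e q q' m t} {v v' w : Valuation} {u s : ℝ}
    (hA : A.BoundedBy e) (h : A.Reach q v m t q' v') (hs : Similar e v u w s) :
    ∃ t' w', A.Reach q w m t' q' w' ∧ Similar e v' (u + t) w' (s + t') := by
  induction h with
  | refl => exact ⟨0, w, .refl, by simpa using hs⟩
  | delay d _ ih =>
    obtain ⟨t', w', h1, h2⟩ := ih
    obtain ⟨d', hd⟩ := h2.delay d
    refine ⟨t' + d', _, h1.delay d', ?_⟩
    push_cast
    rwa [← add_assoc, ← add_assoc]
  | @silent _ _ _ τ _ h1 h2 h3 ih =>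
    obtain ⟨t', w', g1, g2⟩ := ih
    exact ⟨t', _, g1.silent h1 h2 ((g2.sat_iff (hA.guard_le τ h1)).1 h3), g2.reset _⟩


/-! ### First observable events -/

/-- From the state `(q, v)`, after `m` silent transitions and at time `t`, the automaton can take
a transition with the observable action `a`. -/
def ENTA.Observes (A : ENTA) (q : ℕ) (v : Valuation) (m : ℕ) (t : ℝ≥0) (a : ℕ) : Prop :=
  ∃ τ v', A.Reach q v m t τ.src v' ∧ τ ∈ A.trans ∧ τ.act = some a ∧ v'.Sat τ.guard

theorem ENTA.Reach.observes {A : ENTA} {q q' m m' t t' a} {v v' : Valuation}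
    (h : A.Reach q v m t q' v') (h' : A.Observes q' v' m' t' a) :
    A.Observes q v (m + m') (t + t') a := by
  obtain ⟨τ, w, h1, h2⟩ := h'
  exact ⟨τ, w, h.trans h1, h2⟩

theorem ENTA.Reach.observes_of_isRunFrom {A : ENTA} {q₀ t a w} {v₀ : Valuation}
    (ρ : List (ℝ≥0 × Transition)) :
    ∀ {q v m t₀}, A.Reach q₀ v₀ m t₀ q v → A.IsRunFrom q v ρ →
      observablePart (timedTrace t₀ ρ) = (t, a) :: w → ∃ m, A.Observes q₀ v₀ m t a := by
  induction ρ with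
  | nil => intro q v m t₀ _ _ h; simp [timedTrace, observablePart] at h
  | cons x ρ ih =>
    obtain ⟨d, τ⟩ := x
    rintro q v m t₀ hr ⟨h1, rfl, h3, h4⟩ h
    cases hact : τ.act with
    | none =>
      refine ih ((hr.delay d).silent h1 hact h3) h4 ?_
      simpa [timedTrace, observablePart, hact] using h
    | some b =>
      simp only [timedTrace, observablePart, List.filterMap_cons, hact, Option.map_some,
        List.cons.injEq, Prod.mk.injEq] at h
      obtain ⟨⟨rfl, rfl⟩, _⟩ := h
      exact ⟨m, τ, _, hr.delay d, h1, hact, h3⟩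

/-- `Reach` grows at its end, runs are read from their start, and a run cannot end in a delay. Hence
the statement carries a continuation with a first transition, into whose delay a trailing delay is
merged. -/
theorem ENTA.Reach.exists_isRunFrom {A : ENTA} {q q' m t} {v v' : Valuation}
    (h : A.Reach q v m t q' v') (t₀ : ℝ≥0) :
    ∀ d τ ρ, A.IsRunFrom q' v' ((d, τ) :: ρ) → ∃ ρ', A.IsRunFrom q v ρ' ∧
      observablePart (timedTrace t₀ ρ') = observablePart (timedTrace (t₀ + t) ((d, τ) :: ρ)) := by
  induction h with
  | refl => intro d τ ρ hρ; exact ⟨_, hρ, by simp⟩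
  | @delay m t _ v' d₀ _ ih =>
    intro d τ ρ hρ
    obtain ⟨ρ', h1, h2⟩ := ih (d₀ + d) τ ρ (by
      simpa only [ENTA.IsRunFrom, Valuation.delay_delay] using hρ)
    refine ⟨ρ', h1, h2.trans ?_⟩
    simp [timedTrace, add_assoc]
  | @silent m t v' τ' _ h1 h2 h3 ih =>
    intro d τ ρ hρ
    obtain ⟨ρ', g1, g2⟩ := ih 0 τ' ((d, τ) :: ρ)
      ⟨h1, rfl, by rwa [Valuation.delay_zero], by rwa [Valuation.delay_zero]⟩
    refine ⟨ρ', g1, g2.trans ?_⟩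
    simp [timedTrace, observablePart, h2]

theorem ENTA.Observes.singleton_mem_language {A : ENTA} {m t a}
    (h : A.Observes A.init (fun _ => 0) m t a) : [(t, a)] ∈ A.language := by
  obtain ⟨τ, v, h1, h2, h3, h4⟩ := h
  obtain ⟨ρ, g1, g2⟩ := h1.exists_isRunFrom 0 0 τ []
    ⟨h2, rfl, by rwa [Valuation.delay_zero], trivial⟩
  exact ⟨ρ, g1, by rw [g2]; simp [timedTrace, observablePart, h3]⟩

theorem ENTA.mem_firstTimestamp_iff {A : ENTA} {t : ℝ≥0} {a : ℕ} :
    (t, a) ∈ A.firstTimestamp ↔ ∃ m, A.Observes A.init (fun _ => 0) m t a := by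
  constructor
  · rintro ⟨w, ρ, h1, h2⟩
    exact ENTA.Reach.observes_of_isRunFrom ρ .refl h1 h2
  · rintro ⟨m, h⟩
    exact ⟨[], h.singleton_mem_language⟩

theorem ENTA.boundedLanguage_one_subset_iff {A₁ A₂ : ENTA} :
    A₁.boundedLanguage 1 ⊆ A₂.boundedLanguage 1 ↔ A₁.firstTimestamp ⊆ A₂.firstTimestamp := by
  constructor
  · rintro h ⟨t, a⟩ hta
    obtain ⟨m, hm⟩ := ENTA.mem_firstTimestamp_iff.1 hta
    exact ⟨[], (h ⟨hm.singleton_mem_language, by simp⟩).1⟩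
  · rintro h w ⟨hw, hlen⟩
    refine ⟨?_, hlen⟩
    rcases w with _ | ⟨⟨t, a⟩, _ | _⟩
    · exact ⟨[], trivial, rfl⟩
    · obtain ⟨m, hm⟩ := ENTA.mem_firstTimestamp_iff.1 (h ⟨[], hw⟩)
      exact hm.singleton_mem_language
    · simp at hlen

/-! ### Comparison of the first-event timestamps of two automata -/

theorem ENTA.IsPeriodic.mem_add_mul_iff {A : ENTA} {p L : ℕ} (h : A.IsPeriodic p L) {t : ℝ≥0}
    (ht : (p : ℝ≥0) ≤ t) (a k : ℕ) :
    (t, a) ∈ A.firstTimestamp ↔ (t + (k * L : ℕ), a) ∈ A.firstTimestamp := by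
  induction k with
  | zero => simp
  | succ k ih =>
    rw [ih, h.2.2 _ a (le_add_right ht), add_assoc, Nat.succ_mul, Nat.cast_add (k * L)]

theorem exists_eq_add_mul_of_le (t : ℝ≥0) {p L : ℕ} (hL : 0 < L) (ht : (p : ℝ≥0) ≤ t) :
    ∃ s : ℝ≥0, ∃ k : ℕ, (p : ℝ≥0) ≤ s ∧ s < (p + L : ℕ) ∧ t = s + (k * L : ℕ) := by
  have hL' : (0 : ℝ≥0) < L := by exact_mod_cast hL
  obtain ⟨x, rfl⟩ := exists_add_of_le ht
  have h1 : (⌊x / L⌋₊ : ℝ≥0) * L ≤ x := by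
    rw [← le_div_iff₀ hL']; exact Nat.floor_le zero_le
  have h2 : x < (⌊x / L⌋₊ + 1 : ℝ≥0) * L := by
    rw [← div_lt_iff₀ hL']; exact Nat.lt_floor_add_one _
  obtain ⟨y, hy⟩ := exists_add_of_le h1
  refine ⟨p + y, ⌊x / L⌋₊, le_self_add, ?_, ?_⟩
  · push_cast
    refine (add_lt_add_iff_left _).2 ?_
    nth_rewrite 1 [hy] at h2
    rw [add_mul, one_mul] at h2
    exact lt_of_add_lt_add_left h2
  · nth_rewrite 1 [hy]
    push_cast
    ring

/-- A late time is moved by a multiple of the least common multiple into the window that starts at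
the larger threshold; there both periodicities apply, since both periods divide the shift. -/
theorem ENTA.firstTimestamp_subset_iff {A₁ A₂ : ENTA} {p₁ L₁ p₂ L₂ : ℕ}
    (h₁ : A₁.IsPeriodic p₁ L₁) (h₂ : A₂.IsPeriodic p₂ L₂) :
    A₁.firstTimestamp ⊆ A₂.firstTimestamp ↔
      ∀ (t : ℝ≥0) (a : ℕ), t < ((max p₁ p₂ + Nat.lcm L₁ L₂ : ℕ) : ℝ≥0) →
        (t, a) ∈ A₁.firstTimestamp → (t, a) ∈ A₂.firstTimestamp := by
  refine ⟨fun h t a _ ht => h ht, ?_⟩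
  rintro h ⟨t, a⟩ hta
  rcases lt_or_ge t (max p₁ p₂ : ℕ) with hlt | hle
  · exact h t a (hlt.trans_le (by exact_mod_cast Nat.le_add_right _ _)) hta
  · obtain ⟨s, k, hs1, hs2, rfl⟩ := exists_eq_add_mul_of_le t (Nat.lcm_pos h₁.2.1 h₂.2.1) hle
    obtain ⟨l₁, hl₁⟩ := Nat.dvd_lcm_left L₁ L₂
    obtain ⟨l₂, hl₂⟩ := Nat.dvd_lcm_right L₁ L₂
    have e₁ : k * Nat.lcm L₁ L₂ = k * l₁ * L₁ := by rw [hl₁]; ring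
    have e₂ : k * Nat.lcm L₁ L₂ = k * l₂ * L₂ := by rw [hl₂]; ring
    have b₁ : (p₁ : ℝ≥0) ≤ s := le_trans (by exact_mod_cast le_max_left _ _) hs1
    have b₂ : (p₂ : ℝ≥0) ≤ s := le_trans (by exact_mod_cast le_max_right _ _) hs1
    rw [e₁] at hta
    rw [e₂]
    exact (h₂.mem_add_mul_iff b₂ a _).1 (h s a hs2 ((h₁.mem_add_mul_iff b₁ a _).2 hta))

/-! ### Timestamps in the same unit region -/

theorem Similar.aux_lt_iff {e : ℕ} {v w : Valuation} {u s : ℝ} (h : Similar e v u w s) (n : ℤ) :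
    (u < n ↔ s < n) ∧ ((n : ℝ) < u ↔ (n : ℝ) < s) := by
  have h1 := h none (some none) n
  have h2 := h (some none) none (-n)
  simp only [clockPoint] at h1 h2
  push_cast at h1 h2
  simpa only [zero_add, ← sub_eq_add_neg, sub_pos] using And.intro h1 h2

theorem Similar.add_intCast {e : ℕ} {v w : Valuation} {u s : ℝ} (h : Similar e v u w s) (n : ℤ) :
    Similar e v (u + n) w (s + n) := by
  refine Compat.of_shift h 0 0 ?_
  rintro (_ | i)
  · exact ⟨none, n, by simp [clockPoint]⟩
  · exact ⟨some i, 0, by cases i <;> simp [clockPoint]⟩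

/-- A region fixes the auxiliary clock exactly when its value is an integer. This is how transferred
runs are shown to have an exact duration. -/
theorem Similar.aux_eq_intCast {e : ℕ} {v w : Valuation} {u s : ℝ} (h : Similar e v u w s)
    {n : ℤ} (hu : u = n) : s = n := by
  have := h.aux_lt_iff n
  rw [hu] at this
  exact le_antisymm (not_lt.1 fun hs => lt_irrefl _ (this.2.2 hs))
    (not_lt.1 fun hs => lt_irrefl _ (this.1.2 hs))

/-- Two points in time have the same order relations with all natural numbers. -/
def SameUnit (t t' : ℝ≥0) : Prop :=
  ∀ n : ℕ, (t < n ↔ t' < n) ∧ ((n : ℝ≥0) < t ↔ (n : ℝ≥0) < t')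

theorem SameUnit.symm {t t' : ℝ≥0} (h : SameUnit t t') : SameUnit t' t :=
  fun n => ⟨(h n).1.symm, (h n).2.symm⟩

theorem Similar.sameUnit {e : ℕ} {v w : Valuation} {t t' : ℝ≥0} (h : Similar e v t w t') :
    SameUnit t t' := fun n => by
  have := h.aux_lt_iff n
  exact ⟨by exact_mod_cast this.1, by exact_mod_cast this.2⟩

theorem SameUnit.natCast_add {t t' : ℝ≥0} (h : SameUnit t t') (k : ℕ) :
    SameUnit (k + t) (k + t') := by
  intro n
  rcases le_total k n with hkn | hkn
  · obtain ⟨m, rfl⟩ := Nat.exists_eq_add_of_le hkn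
    simpa using h m
  · have hk : (n : ℝ≥0) ≤ k := by exact_mod_cast hkn
    refine ⟨iff_of_false (not_lt.2 (le_add_right hk)) (not_lt.2 (le_add_right hk)), ?_⟩
    have h0 := (h 0).2
    rcases hkn.lt_or_eq with hlt | rfl
    · have hk : (n : ℝ≥0) < k := by exact_mod_cast hlt
      exact iff_of_true (lt_add_of_lt_of_nonneg hk zero_le) (lt_add_of_lt_of_nonneg hk zero_le)
    · simpa using h0

theorem clockPoint_zero_some (e : ℕ) (u : ℝ) (i : Option (Fin (e + 1))) :
    clockPoint e (fun _ => 0) u (some i) = 0 := by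
  cases i <;> simp [clockPoint]

theorem SameUnit.similar_zero {t t' : ℝ≥0} (h : SameUnit t t') (e : ℕ) :
    Similar e (fun _ => 0) (-t) (fun _ => 0) (-t') := by
  have e1 : ∀ t : ℝ≥0, clockPoint e (fun _ => 0) (-t) none = -t := fun _ => rfl
  have key : ∀ n : ℤ, ((t : ℝ) < n ↔ (t' : ℝ) < n) ∧ ((n : ℝ) < t ↔ (n : ℝ) < t') := by
    intro n
    rcases lt_or_ge n 0 with hn | hn
    · have hn : (n : ℝ) < 0 := by exact_mod_cast hn
      have := t.2
      have := t'.2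
      exact ⟨iff_of_false (by linarith) (by linarith), iff_of_true (by linarith) (by linarith)⟩
    · lift n to ℕ using hn
      have := h n
      exact ⟨by exact_mod_cast this.1, by exact_mod_cast this.2⟩
  rintro (_ | i) (_ | j) n <;> simp only [clockPoint_zero_some, e1]
  · simp
  · have := (key (-n)).2
    push_cast at this
    constructor <;> intro hh
    · linarith [this.1 (by linarith)]
    · linarith [this.2 (by linarith)]
  · have := (key n).1
    constructor <;> intro hh
    · linarith [this.1 (by linarith)]
    · linarith [this.2 (by linarith)]

theorem ENTA.Observes.transfer {A : ENTA} {e q m t a} {v w : Valuation} {u s : ℝ}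
    (hA : A.BoundedBy e) (h : A.Observes q v m t a) (hs : Similar e v u w s) :
    ∃ t' v' w', A.Observes q w m t' a ∧ Similar e v' (u + t) w' (s + t') := by
  obtain ⟨τ, v', h1, h2, h3, h4⟩ := h
  obtain ⟨t', w', g1, g2⟩ := h1.transfer hA hs
  exact ⟨t', v', w', ⟨τ, w', g1, h2, h3, (g2.sat_iff (hA.guard_le τ h2)).1 h4⟩, g2⟩

/-- With the auxiliary clock started at `-t` and `-t'`, the first run shows `0` at the event. So
does the transferred run, whose event therefore occurs exactly at `t'`. -/
theorem ENTA.Observes.of_sameUnit {A : ENTA} {e m t t' a} (hA : A.BoundedBy e)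
    (h : A.Observes A.init (fun _ => 0) m t a) (ht : SameUnit t t') :
    A.Observes A.init (fun _ => 0) m t' a := by
  obtain ⟨s, v', w', h1, h2⟩ := h.transfer hA (ht.similar_zero e)
  have := h2.aux_eq_intCast (n := 0) (by simp)
  obtain rfl : s = t' := by
    rw [← NNReal.coe_inj]
    push_cast at this
    linarith
  exact h1

/-! ### Regions -/

/-- The order relations that determine the region of a valuation with an auxiliary clock. -/
abbrev Region (e : ℕ) : Type :=
  Option (Option (Fin (e + 1))) → Option (Option (Fin (e + 1))) → Fin (2 * e + 4) → Bool

open Classical in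
/-- The region of a valuation with an auxiliary clock. -/
noncomputable def region (e : ℕ) (v : Valuation) (u : ℝ) : Region e := fun i j k =>
  decide (clockPoint e v u i < clockPoint e v u j + (((k : ℕ) - (e + 1) : ℤ) : ℝ))

theorem Similar.region_eq {e : ℕ} {v w : Valuation} {u s : ℝ} (h : Similar e v u w s) :
    region e v u = region e w s := by
  funext i j k
  exact decide_eq_decide.2 (h i j _)

theorem clockPoint_mem_Icc {e : ℕ} {v : Valuation} {u : ℝ} (h0 : 0 ≤ u) (h1 : u < 1)
    (i : Option (Option (Fin (e + 1)))) : 0 ≤ clockPoint e v u i ∧ clockPoint e v u i ≤ e + 1 := by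
  have he : (0 : ℝ) ≤ e := Nat.cast_nonneg e
  rcases i with _ | _ | c
  · simp only [clockPoint]
    exact ⟨h0, by linarith⟩
  · simp only [clockPoint]
    exact ⟨le_rfl, by linarith⟩
  · rcases clockPoint_clock (v := v) (u := u) c with ⟨a, b⟩ | ⟨a, b⟩
    · have a : (v c : ℝ) ≤ e := by exact_mod_cast a
      rw [b]
      exact ⟨(v c).2, by linarith⟩
    · rw [b]
      exact ⟨by linarith, le_rfl⟩

/-- All entries lie in `[0, e + 1]`, so constraints with bounds outside a finite window are
constantly true or constantly false. -/
theorem similar_of_region_eq {e : ℕ} {v w : Valuation} {u s : ℝ} (hu0 : 0 ≤ u) (hu1 : u < 1)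
    (hs0 : 0 ≤ s) (hs1 : s < 1) (h : region e v u = region e w s) : Similar e v u w s := by
  intro i j n
  have a1 := clockPoint_mem_Icc (v := v) hu0 hu1 i
  have a2 := clockPoint_mem_Icc (v := v) hu0 hu1 j
  have b1 := clockPoint_mem_Icc (v := w) hs0 hs1 i
  have b2 := clockPoint_mem_Icc (v := w) hs0 hs1 j
  rcases lt_or_ge n (-(e + 1)) with hn | hn
  · have hn : (n : ℝ) < -(e + 1) := by exact_mod_cast hn
    exact iff_of_false (by linarith) (by linarith)
  rcases lt_or_ge n (e + 3) with hn' | hn'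
  -- The window `-(e + 1) ≤ n ≤ e + 2` contains `2 * e + 4` integers.
  · have hk : (n + (e + 1)).toNat < 2 * e + 4 := by omega
    have := decide_eq_decide.1 (congrFun (congrFun (congrFun h i) j) ⟨_, hk⟩)
    have e1 : (((n + (e + 1)).toNat : ℕ) : ℤ) - (e + 1) = n := by omega
    simpa only [e1] using this
  · have hn : ((e : ℝ) + 3) ≤ n := by exact_mod_cast hn'
    exact iff_of_true (by linarith) (by linarith)

/-- The number of pairs of a location `q ≤ e` and a region. -/
def regionBound (e : ℕ) : ℕ :=
  (e + 1) * ((2 ^ (2 * e + 4)) ^ (e + 3)) ^ (e + 3)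

theorem card_region (e : ℕ) : Nat.card (Fin (e + 1) × Region e) = regionBound e := by
  simp [Nat.card_eq_fintype_card, regionBound]

/-! ### Periodicity -/

/-- Two of the iterates with indices `0, …, M` coincide, so from an index at most `M` on the orbit
has a period at most `M`, which divides `M!`. The factorial avoids knowing the actual period. -/
theorem iterate_add_factorial {α : Type*} [Finite α] (f : α → α) (x : α) {M n : ℕ}
    (hM : Nat.card α ≤ M) (hn : M ≤ n) : f^[n + M.factorial] x = f^[n] x := by
  cases nonempty_fintype α
  obtain ⟨i, j, hij, hf⟩ := Fintype.exists_ne_map_eq_of_card_lt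
    (fun i : Fin (M + 1) => f^[i] x) (by
      rw [Fintype.card_fin, ← Nat.card_eq_fintype_card]; omega)
  wlog hlt : i < j generalizing i j
  · exact this j i hij.symm hf.symm (lt_of_le_of_ne (not_lt.1 hlt) hij.symm)
  have hlt' : (i : ℕ) < j := hlt
  have hj : (j : ℕ) ≤ M := Nat.le_of_lt_succ j.2
  have hp : Function.IsPeriodicPt f (j - i) (f^[i] x) := by
    rw [Function.IsPeriodicPt, Function.IsFixedPt, ← Function.iterate_add_apply,
      Nat.sub_add_cancel hlt'.le]
    exact hf.symm
  have hp' : f^[M.factorial] (f^[i] x) = f^[i] x :=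
    hp.trans_dvd (Nat.dvd_factorial (by omega) (by omega))
  obtain ⟨k, rfl⟩ := Nat.exists_eq_add_of_le (show (i : ℕ) ≤ n by omega)
  rw [show (i : ℕ) + k + M.factorial = k + (M.factorial + i) by ring, Function.iterate_add_apply,
    Function.iterate_add_apply f M.factorial, hp', ← Function.iterate_add_apply, add_comm]

/-- The locations and regions in which `A` can be at time `n` after silent transitions. -/
def ENTA.silentRegions (A : ENTA) (e n : ℕ) : Set (Fin (e + 1) × Region e) :=
  {r | ∃ q v m, A.Reach A.init (fun _ => 0) m n q v ∧ q = r.1 ∧ region e v 0 = r.2}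

/-- The locations and regions that can be reached by silent transitions in one unit of time. -/
def ENTA.silentStep (A : ENTA) (e : ℕ) (X : Set (Fin (e + 1) × Region e)) :
    Set (Fin (e + 1) × Region e) :=
  {r' | ∃ r ∈ X, ∃ v q' v' m, A.Reach r.1 v m 1 q' v' ∧ region e v 0 = r.2 ∧ q' = r'.1 ∧
    region e v' 0 = r'.2}

/-- One inclusion cuts a run at time `n`. For the other, the unit step may start from a different
valuation of the same region, so it is transferred to the one actually reached. -/
theorem ENTA.silentRegions_succ {A : ENTA} {e : ℕ} (hA : A.BoundedBy e) (n : ℕ) :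
    A.silentRegions e (n + 1) = A.silentStep e (A.silentRegions e n) := by
  ext r'
  constructor
  · rintro ⟨q', v', m, h1, h2, h3⟩
    obtain ⟨m₁, m₂, q, v, g1, g2⟩ := h1.split_time n (by simp)
    have hq := g1.loc_le hA hA.init_le
    refine ⟨(⟨q, Nat.lt_succ_of_le hq⟩, region e v 0), ⟨q, v, m₁, g1, rfl, rfl⟩, v, q', v', m₂,
      ?_, rfl, h2, h3⟩
    simpa using g2
  · rintro ⟨r, ⟨q, w, m₁, h1, rfl, h3⟩, v, q', v', m₂, g1, g2, g3, g4⟩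
    obtain ⟨t', w', k1, k2⟩ := g1.transfer hA
      (similar_of_region_eq le_rfl zero_lt_one le_rfl zero_lt_one (g2.trans h3.symm))
    -- The auxiliary clock runs from `0` to `1` in the original step, so the transferred step also
    -- lasts exactly one unit.
    have := k2.aux_eq_intCast (n := 1) (by simp)
    obtain rfl : t' = 1 := by
      rw [← NNReal.coe_inj]
      push_cast at this ⊢
      linarith
    refine ⟨q', w', m₁ + m₂, by simpa using h1.trans k1, g3, ?_⟩
    rw [← g4]
    have := (k2.add_intCast (-1)).region_eq
    simpa using this.symm

theorem ENTA.silentRegions_eq_iterate {A : ENTA} {e : ℕ} (hA : A.BoundedBy e) (n : ℕ) :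
    A.silentRegions e n = (A.silentStep e)^[n] (A.silentRegions e 0) := by
  induction n with
  | zero => rfl
  | succ n ih => rw [silentRegions_succ hA, ih, Function.iterate_succ_apply']

/-- The part of the run after time `n` is transplanted to a state of the same region reachable at
time `n'`. The transplanted event occurs only in the same unit as `n' + s`;
`ENTA.Observes.of_sameUnit` corrects the time. -/
theorem ENTA.mem_firstTimestamp_of_silentRegions_eq {A : ENTA} {e n n' a : ℕ} {s : ℝ≥0}
    (hA : A.BoundedBy e) (h : A.silentRegions e n = A.silentRegions e n')
    (hs : (n + s, a) ∈ A.firstTimestamp) : (n' + s, a) ∈ A.firstTimestamp := by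
  obtain ⟨m, τ, v', h1, h2⟩ := ENTA.mem_firstTimestamp_iff.1 hs
  obtain ⟨m₁, m₂, q, v, g1, g2⟩ := h1.split_time n (by simp)
  rw [add_tsub_cancel_left] at g2
  have hq := g1.loc_le hA hA.init_le
  obtain ⟨q', w, m', k1, rfl, k3⟩ : ((⟨q, Nat.lt_succ_of_le hq⟩, region e v 0) :
      Fin (e + 1) × Region e) ∈ A.silentRegions e n' := by
    rw [← h]; exact ⟨q, v, m₁, g1, rfl, rfl⟩
  have hobs : A.Observes q' v m₂ s a := ⟨τ, v', g2, h2⟩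
  obtain ⟨t', x, y, l1, l2⟩ := hobs.transfer hA
    (similar_of_region_eq le_rfl zero_lt_one le_rfl zero_lt_one k3.symm)
  rw [zero_add, zero_add] at l2
  exact ENTA.mem_firstTimestamp_iff.2
    ⟨_, (k1.observes l1).of_sameUnit hA (l2.sameUnit.symm.natCast_add n')⟩

/-- A bound for the number of sets of locations and regions. -/
def periodBound (e : ℕ) : ℕ :=
  2 ^ regionBound e

theorem ENTA.BoundedBy.isPeriodic {A : ENTA} {e : ℕ} (hA : A.BoundedBy e) :
    A.IsPeriodic (periodBound e) (periodBound e).factorial := by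
  refine ⟨Nat.two_pow_pos _, Nat.factorial_pos _, fun t a ht => ?_⟩
  have hn : periodBound e ≤ ⌊t⌋₊ := Nat.le_floor ht
  have heq : A.silentRegions e ⌊t⌋₊ = A.silentRegions e (⌊t⌋₊ + (periodBound e).factorial) := by
    rw [ENTA.silentRegions_eq_iterate hA, ENTA.silentRegions_eq_iterate hA (_ + _)]
    refine (iterate_add_factorial _ _ ?_ hn).symm
    rw [Nat.card_eq_fintype_card, Fintype.card_set, ← Nat.card_eq_fintype_card, card_region,
      periodBound]
  obtain ⟨s, hs⟩ := exists_add_of_le (Nat.floor_le (zero_le (a := t)))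
  have e1 : t + (periodBound e).factorial =
      ((⌊t⌋₊ + (periodBound e).factorial : ℕ) : ℝ≥0) + s := by
    nth_rewrite 1 [hs]
    push_cast
    ring
  rw [e1]
  nth_rewrite 1 [hs]
  exact ⟨ENTA.mem_firstTimestamp_of_silentRegions_eq hA heq,
    ENTA.mem_firstTimestamp_of_silentRegions_eq hA heq.symm⟩


/-! ### A bound for the number of silent transitions -/

theorem SameUnit.trans {r s t : ℝ≥0} (h : SameUnit r s) (h' : SameUnit s t) : SameUnit r t :=
  fun n => ⟨(h n).1.trans (h' n).1, (h n).2.trans (h' n).2⟩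

theorem SameUnit.floor_eq {t t' : ℝ≥0} (h : SameUnit t t') : ⌊t⌋₊ = ⌊t'⌋₊ := by
  refine eq_of_forall_le_iff fun n => ?_
  rw [Nat.le_floor_iff zero_le, Nat.le_floor_iff zero_le, ← not_lt, ← not_lt]
  exact not_congr (h n).1

/-- Pigeonhole on the `m + 1` cuts after each number of silent transitions: two agree in location,
in the integer part of the time, and in the region with the fractional part of the time as auxiliary
clock. The segment between them is removed. Recording the time in this way keeps the event in its
unit. -/
theorem ENTA.Observes.exists_lt {A : ENTA} {e m t a} (hA : A.BoundedBy e)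
    (h : A.Observes A.init (fun _ => 0) m t a) (hm : (⌊t⌋₊ + 1) * regionBound e ≤ m) :
    ∃ m' < m, ∃ t', SameUnit t t' ∧ A.Observes A.init (fun _ => 0) m' t' a := by
  obtain ⟨τ, v', hr, hτ⟩ := h
  choose s s' q v hs h1 h2 using fun i : Fin (m + 1) =>
    hr.split_count i (Nat.le_of_lt_succ i.2)
  have hq i : q i < e + 1 := Nat.lt_succ_of_le ((h1 i).loc_le hA hA.init_le)
  have hst i : s i ≤ t := by rw [← hs i]; exact le_self_add
  have hfl i : ⌊s i⌋₊ < ⌊t⌋₊ + 1 := Nat.lt_succ_of_le (Nat.floor_mono (hst i))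
  obtain ⟨i, j, hij, hf⟩ := Fintype.exists_ne_map_eq_of_card_lt
    (β := Fin (⌊t⌋₊ + 1) × (Fin (e + 1) × Region e))
    (fun i : Fin (m + 1) => (⟨_, hfl i⟩, ⟨_, hq i⟩, region e (v i) (s i - ⌊s i⌋₊))) (by
      rw [Fintype.card_prod, Fintype.card_fin, Fintype.card_fin, ← Nat.card_eq_fintype_card,
        card_region]
      omega)
  wlog hlt : i < j generalizing i j
  · exact this j i hij.symm hf.symm (lt_of_le_of_ne (not_lt.1 hlt) hij.symm)
  simp only [Prod.mk.injEq, Fin.mk.injEq] at hf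
  obtain ⟨f1, f2, f3⟩ := hf
  have fr i : (0 : ℝ) ≤ s i - ⌊s i⌋₊ ∧ (s i - ⌊s i⌋₊ : ℝ) < 1 := by
    have a : ((⌊s i⌋₊ : ℝ≥0) : ℝ) ≤ s i := by exact_mod_cast Nat.floor_le (zero_le (a := s i))
    have b : (s i : ℝ) < ((⌊s i⌋₊ + 1 : ℝ≥0) : ℝ) := by exact_mod_cast Nat.lt_floor_add_one (s i)
    push_cast at a b
    exact ⟨by linarith, by linarith⟩
  have hobs : A.Observes (q j) (v j) (m - j) (s' j) a := ⟨τ, v', h2 j, hτ⟩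
  obtain ⟨t', x, y, g1, g2⟩ := hobs.transfer hA
    (similar_of_region_eq (fr j).1 (fr j).2 (fr i).1 (fr i).2 f3.symm)
  rw [← f2] at g1
  have hlt' : (i : ℕ) < j := hlt
  refine ⟨i + (m - j), by have := j.2; omega, s i + t', ?_, (h1 i).observes g1⟩
  -- Restoring the common integer part turns the auxiliary clocks into the two event times.
  have g3 := g2.add_intCast ⌊s j⌋₊
  rw [← f1] at g3
  refine Similar.sameUnit (e := e) (v := x) (w := y) ?_
  rw [← hs j]
  push_cast
  push_cast at g3
  convert g3 using 1 <;> ring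

/-- Removing segments can be repeated, because the bound depends only on the integer part of the
event time, which is preserved. -/
theorem ENTA.Observes.exists_lt_bound {A : ENTA} {e m t a} (hA : A.BoundedBy e)
    (h : A.Observes A.init (fun _ => 0) m t a) :
    ∃ m' < (⌊t⌋₊ + 1) * regionBound e, ∃ t', SameUnit t t' ∧
      A.Observes A.init (fun _ => 0) m' t' a := by
  induction m using Nat.strong_induction_on generalizing t with
  | _ m ih =>
    rcases lt_or_ge m ((⌊t⌋₊ + 1) * regionBound e) with hm | hm
    · exact ⟨m, hm, t, fun _ => ⟨Iff.rfl, Iff.rfl⟩, h⟩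
    · obtain ⟨m', hm', t', ht, h'⟩ := h.exists_lt hA hm
      obtain ⟨m'', hm'', t'', ht', h''⟩ := ih m' hm' h'
      exact ⟨m'', by rwa [ht.floor_eq], t'', ht.trans ht', h''⟩

/-! ### Moving time points to a grid -/

/-- The time `x`, moved to a multiple of `1 / D`, in units of `1 / D`: the fractional part is
replaced by its rank among the fractional parts of the members of `F`. -/
noncomputable def gridMap (D : ℕ) (F : Finset ℝ≥0) (x : ℝ≥0) : ℕ :=
  D * ⌊x⌋₊ + {g ∈ F | Int.fract (NNReal.toReal g) < Int.fract (x : ℝ)}.card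

theorem gridMap_add_natCast (D : ℕ) (F : Finset ℝ≥0) (x : ℝ≥0) (n : ℕ) :
    gridMap D F (x + n) = gridMap D F x + n * D := by
  unfold gridMap
  rw [Nat.floor_add_natCast zero_le, NNReal.coe_add, NNReal.coe_natCast, Int.fract_add_natCast]
  ring

/-- Ranks stay below `D`, so they never spill over into the next integer. Within one unit, the
member of `F` with the fractional part of `x` is counted for `y` but not for `x`, which gives
strictness. -/
theorem gridMap_lt_gridMap {D : ℕ} {F : Finset ℝ≥0} (hD : F.card < D) {x y : ℝ≥0}
    (hx : ∃ g ∈ F, Int.fract (g : ℝ) = Int.fract (x : ℝ)) (hxy : x < y) :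
    gridMap D F x < gridMap D F y := by
  unfold gridMap
  rcases (Nat.floor_mono hxy.le).lt_or_eq with hlt | heq
  · have h1 : {g ∈ F | Int.fract (NNReal.toReal g) < Int.fract (x : ℝ)}.card < D :=
      (Finset.card_filter_le _ _).trans_lt hD
    calc _ < D * ⌊x⌋₊ + D := by omega
      _ = D * (⌊x⌋₊ + 1) := by ring
      _ ≤ D * ⌊y⌋₊ := Nat.mul_le_mul_left _ hlt
      _ ≤ _ := Nat.le_add_right _ _
  · have hfr : Int.fract (x : ℝ) < Int.fract (y : ℝ) := by
      have e1 : ∀ z : ℝ≥0, Int.fract (z : ℝ) = z - (⌊z⌋₊ : ℝ) := fun z => by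
        rw [Int.fract, ← natCast_floor_eq_intCast_floor z.coe_nonneg]
        exact congrArg (fun n : ℕ => (z : ℝ) - n) (Nonneg.nat_floor_coe z)
      rw [e1, e1, heq]
      have : (x : ℝ) < y := hxy
      linarith
    rw [heq]
    refine Nat.add_lt_add_left (Finset.card_lt_card ?_) _
    obtain ⟨g, hg, hgx⟩ := hx
    refine ⟨fun z hz => ?_, fun hsub => ?_⟩
    · rw [Finset.mem_filter] at hz ⊢
      exact ⟨hz.1, hz.2.trans hfr⟩
    · have : g ∈ {g ∈ F | Int.fract (NNReal.toReal g) < Int.fract (x : ℝ)} :=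
        hsub (Finset.mem_filter.2 ⟨hg, hgx ▸ hfr⟩)
      rw [Finset.mem_filter, hgx] at this
      exact lt_irrefl _ this.2

/-- The grid map is strictly monotone on integer translates of `F` and carries integers to multiples
of `D`; hence it respects the difference constraints that guards express. -/
theorem lt_add_natCast_iff_gridMap {D : ℕ} {F : Finset ℝ≥0} (hD : F.card < D) {s t : ℝ≥0}
    (hs : s ∈ F) (ht : t ∈ F) (n : ℕ) :
    (t < s + n ↔ gridMap D F t < gridMap D F s + n * D) ∧
      (s + n < t ↔ gridMap D F s + n * D < gridMap D F t) := by
  rw [← gridMap_add_natCast]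
  have h1 : ∃ g ∈ F, Int.fract (g : ℝ) = Int.fract ((s + n : ℝ≥0) : ℝ) :=
    ⟨s, hs, by rw [NNReal.coe_add, NNReal.coe_natCast, Int.fract_add_natCast]⟩
  rcases lt_trichotomy t (s + n) with h | h | h
  · have := gridMap_lt_gridMap hD ⟨t, ht, rfl⟩ h
    exact ⟨iff_of_true h this, iff_of_false h.not_gt this.not_gt⟩
  · rw [h]
    exact ⟨iff_of_false (lt_irrefl _) (lt_irrefl _), iff_of_false (lt_irrefl _) (lt_irrefl _)⟩
  · have := gridMap_lt_gridMap hD h1 h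
    exact ⟨iff_of_false h.not_gt this.not_gt, iff_of_true h this⟩

theorem gridMap_zero (D : ℕ) (F : Finset ℝ≥0) : gridMap D F 0 = 0 := by
  simp [gridMap, not_lt.2 (Int.fract_nonneg _)]

theorem gridMap_le_gridMap {D : ℕ} {F : Finset ℝ≥0} (hD : F.card < D) {x y : ℝ≥0}
    (hx : x ∈ F) (hxy : x ≤ y) : gridMap D F x ≤ gridMap D F y := by
  rcases hxy.lt_or_eq with h | rfl
  · exact (gridMap_lt_gridMap hD ⟨x, hx, rfl⟩ h).le
  · exact le_rfl

theorem sameUnit_gridMap {D : ℕ} {F : Finset ℝ≥0} (hD : F.card < D) {t : ℝ≥0}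
    (h0 : 0 ∈ F) (ht : t ∈ F) : SameUnit t (gridMap D F t / D) := by
  have hD' : (0 : ℝ≥0) < D := by exact_mod_cast (Nat.zero_le _).trans_lt hD
  intro n
  have := lt_add_natCast_iff_gridMap hD h0 ht n
  rw [gridMap_zero, zero_add, zero_add] at this
  rw [div_lt_iff₀ hD', lt_div_iff₀ hD']
  exact ⟨by exact_mod_cast this.1, by exact_mod_cast this.2⟩

/-! ### Silent runs on a grid -/

/-- The duration of a list of delays and transitions, latest first. -/
def histTime : List (ℕ × Transition) → ℕ
  | [] => 0
  | x :: h => x.1 + histTime h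

/-- The value of the clock `c` after a list of delays and transitions, latest first. -/
def histClock (c : ℕ) : List (ℕ × Transition) → ℕ
  | [] => 0
  | x :: h => if c ∈ x.2.reset then 0 else x.1 + histClock c h

/-- The location reached from `q` by a list of delays and transitions, latest first. -/
def histLoc (q : ℕ) : List (ℕ × Transition) → ℕ
  | [] => q
  | x :: _ => x.2.tgt

/-- After the history `h` and a further delay `x.1`, the transition `x.2` of `A` can be taken. Time
is measured in units of `1 / D`. -/
def ENTA.HistEnabled (A : ENTA) (D : ℕ) (h : List (ℕ × Transition)) (x : ℕ × Transition) : Prop :=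
  x.2 ∈ A.trans ∧ x.2.src = histLoc A.init h ∧
    ∀ k ∈ x.2.guard, k.cmp.Holds (x.1 + histClock k.clock h : ℕ) (k.bound * D : ℕ)

/-- The list `h`, latest first, is a run of silent transitions, with delays in units of `1 / D`. -/
def ENTA.IsHist (A : ENTA) (D : ℕ) : List (ℕ × Transition) → Prop
  | [] => True
  | x :: h => (A.HistEnabled D h x ∧ x.2.act = none) ∧ A.IsHist D h

theorem Cmp.holds_div_iff {D : ℕ} (hD : 0 < D) (c : Cmp) (x n : ℕ) :
    c.Holds (x / D : ℝ≥0) n ↔ c.Holds (x : ℕ) (n * D : ℕ) := by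
  have hD' : (0 : ℝ≥0) < D := by exact_mod_cast hD
  push_cast
  exact Cmp.holds_congr (div_lt_iff₀ hD') (lt_div_iff₀ hD') c

theorem ENTA.HistEnabled.sat {A : ENTA} {D : ℕ} (hD : 0 < D) {h x} (hx : A.HistEnabled D h x) :
    (Valuation.delay (fun c => (histClock c h / D : ℝ≥0)) (x.1 / D)).Sat x.2.guard := by
  intro k hk
  have := (Cmp.holds_div_iff hD _ _ _).2 (hx.2.2 k hk)
  simpa [Valuation.delay, add_div, add_comm] using this

theorem ENTA.IsHist.reach {A : ENTA} {D : ℕ} (hD : 0 < D) :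
    ∀ {h}, A.IsHist D h → A.Reach A.init (fun _ => 0) h.length (histTime h / D : ℝ≥0)
      (histLoc A.init h) (fun c => (histClock c h / D : ℝ≥0))
  | [], _ => by simpa [histTime, histLoc, histClock] using ENTA.Reach.refl
  | x :: h, hh => by
    have h1 := (hh.2.reach hD).delay (x.1 / D)
    rw [← hh.1.1.2.1] at h1
    have h2 := h1.silent hh.1.1.1 hh.1.2 (hh.1.1.sat hD)
    convert h2 using 1
    · rfl
    · simp [histTime, add_div, add_comm]
    · rfl
    · funext c
      simp only [histClock, Valuation.reset, Valuation.delay]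
      split_ifs
      · simp
      · simp [add_div, add_comm]

theorem ENTA.IsHist.observes {A : ENTA} {D a : ℕ} (hD : 0 < D) {h x} (hh : A.IsHist D h)
    (hx : A.HistEnabled D h x) (ha : x.2.act = some a) :
    A.Observes A.init (fun _ => 0) h.length ((histTime h + x.1 : ℕ) / D : ℝ≥0) a := by
  have h1 := (hh.reach hD).delay (x.1 / D)
  rw [← hx.2.1] at h1
  refine ⟨x.2, _, ?_, hx.1, ha, hx.sat hD⟩
  convert h1 using 1
  push_cast
  rw [add_div]

/-- A clock value is the difference between the present `t` and the time `s` of the last reset, both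
in `F`. -/
theorem holds_iff_gridMap {D : ℕ} {F : Finset ℝ≥0} (hD : F.card < D) {s t x : ℝ≥0} {y n : ℕ}
    (hs : s ∈ F) (ht : t ∈ F) (hx : s + x = t) (hy : gridMap D F s + y = gridMap D F t) (c : Cmp) :
    c.Holds x n ↔ c.Holds (y : ℕ) (n * D : ℕ) := by
  have := lt_add_natCast_iff_gridMap hD hs ht n
  rw [← hy, ← hx] at this
  simp only [add_lt_add_iff_left] at this
  refine Cmp.holds_congr ?_ ?_ c
  · exact_mod_cast this.1
  · exact_mod_cast this.2

/-- `F` collects `0` and the times of the silent transitions; `t₁` is the latest of them, and each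
clock is represented by the time `s` of its last reset. The grid map depends on the whole set of
times, which grows during the induction, so the claim is made for every larger set `G`. -/
theorem ENTA.Reach.exists_isHist {A : ENTA} {m t q} {v : Valuation}
    (h : A.Reach A.init (fun _ => 0) m t q v) :
    ∃ F : Finset ℝ≥0, F.card ≤ m + 1 ∧ 0 ∈ F ∧ ∀ G, F ⊆ G → ∀ D, G.card < D →
      ∃ h, A.IsHist D h ∧ h.length = m ∧ histLoc A.init h = q ∧
        ∃ t₁ ∈ F, t₁ ≤ t ∧ histTime h = gridMap D G t₁ ∧
          ∀ c, ∃ s ∈ F, s + v c = t ∧ gridMap D G s + histClock c h = gridMap D G t₁ := by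
  classical
  induction h with
  | refl =>
    refine ⟨{0}, by simp, by simp, fun G _ D _ => ⟨[], trivial, rfl, rfl, 0, by simp, le_rfl, ?_,
      fun c => ⟨0, by simp, by simp, by simp [histClock]⟩⟩⟩
    simp [histTime, gridMap_zero]
  | delay d _ ih =>
    obtain ⟨F, h1, h2, h3⟩ := ih
    refine ⟨F, h1, h2, fun G hG D hD => ?_⟩
    obtain ⟨h, g1, g2, g3, t₁, g4, g5, g6, g7⟩ := h3 G hG D hD
    refine ⟨h, g1, g2, g3, t₁, g4, le_add_right g5, g6, fun c => ?_⟩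
    obtain ⟨s, k1, k2, k3⟩ := g7 c
    exact ⟨s, k1, by rw [← k2, Valuation.delay, add_assoc], k3⟩
  | @silent m t v τ _ a1 a2 a3 ih =>
    obtain ⟨F, h1, h2, h3⟩ := ih
    refine ⟨insert t F, (Finset.card_insert_le _ _).trans (by omega),
      Finset.mem_insert_of_mem h2, fun G hG D hD => ?_⟩
    have hF : F ⊆ G := (Finset.subset_insert t F).trans hG
    have htG : t ∈ G := hG (Finset.mem_insert_self t F)
    obtain ⟨h, g1, g2, g3, t₁, g4, g5, g6, g7⟩ := h3 G hF D hD
    have hle := gridMap_le_gridMap hD (hF g4) g5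
    refine ⟨(gridMap D G t - gridMap D G t₁, τ) :: h, ⟨⟨⟨a1, g3.symm, fun k hk => ?_⟩, a2⟩, g1⟩,
      by simp [g2], rfl, t, Finset.mem_insert_self t F, le_rfl, ?_, fun c => ?_⟩
    · obtain ⟨s, k1, k2, k3⟩ := g7 k.clock
      exact (holds_iff_gridMap hD (hF k1) htG k2 (by omega) _).1 (a3 k hk)
    · simp only [histTime]
      omega
    · by_cases hc : c ∈ τ.reset
      · exact ⟨t, Finset.mem_insert_self t F, by simp [Valuation.reset, hc],
          by simp [histClock, hc]⟩
      · obtain ⟨s, k1, k2, k3⟩ := g7 c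
        refine ⟨s, Finset.mem_insert_of_mem k1, by simpa [Valuation.reset, hc] using k2, ?_⟩
        simp only [histClock, hc, if_false]
        omega

theorem ENTA.Observes.exists_isHist {A : ENTA} {m t a}
    (h : A.Observes A.init (fun _ => 0) m t a) {D : ℕ} (hD : m + 2 < D) :
    ∃ h x, A.IsHist D h ∧ h.length = m ∧ A.HistEnabled D h x ∧ x.2.act = some a ∧
      SameUnit t ((histTime h + x.1 : ℕ) / D) := by
  classical
  obtain ⟨τ, v, hr, hτ, ha, hsat⟩ := h
  obtain ⟨F, h1, h2, h3⟩ := hr.exists_isHist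
  -- At most `m + 1` times in `F`, and one more for the observable event.
  have hD' : (insert t F).card < D := (Finset.card_insert_le _ _).trans_lt (by omega)
  have htG : t ∈ insert t F := Finset.mem_insert_self t F
  have hF : F ⊆ insert t F := Finset.subset_insert t F
  obtain ⟨h, g1, g2, g3, t₁, g4, g5, g6, g7⟩ := h3 _ hF D hD'
  have hle := gridMap_le_gridMap hD' (hF g4) g5
  refine ⟨h, (gridMap D (insert t F) t - gridMap D (insert t F) t₁, τ), g1, g2,
    ⟨hτ, g3.symm, fun k hk => ?_⟩, ha, ?_⟩
  · obtain ⟨s, k1, k2, k3⟩ := g7 k.clock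
    exact (holds_iff_gridMap hD' (hF k1) htG k2 (by omega) _).1 (hsat k hk)
  · rw [g6, Nat.add_sub_cancel' hle]
    exact sameUnit_gridMap hD' (hF h2) htG


/-! ### First events at multiples of one half -/

/-- A unit class is given by the integer part and by whether the number is an integer, which is a
decidable condition on numerators and denominators. -/
theorem sameUnit_natCast_div_iff {D D' : ℕ} (hD : 0 < D) (hD' : 0 < D') (T k : ℕ) :
    SameUnit (T / D) (k / D') ↔ T / D = k / D' ∧ (T % D = 0 ↔ k % D' = 0) := by
  have hc : (0 : ℝ≥0) < D := by exact_mod_cast hD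
  have hc' : (0 : ℝ≥0) < D' := by exact_mod_cast hD'
  have key : SameUnit (T / D) (k / D') ↔
      ∀ n : ℕ, (T / D < n ↔ k / D' < n) ∧ (n * D < T ↔ n * D' < k) := by
    refine forall_congr' fun n => ?_
    rw [div_lt_iff₀ hc, div_lt_iff₀ hc', lt_div_iff₀ hc, lt_div_iff₀ hc',
      Nat.div_lt_iff_lt_mul hD, Nat.div_lt_iff_lt_mul hD']
    norm_cast
  have hmul : ∀ {D : ℕ}, 0 < D → ∀ T n : ℕ, n * D < T ↔ n < T / D ∨ (n = T / D ∧ T % D ≠ 0) := by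
    intro D hD T n
    have h1 := Nat.div_add_mod T D
    have h2 := Nat.mod_lt T hD
    rcases lt_trichotomy n (T / D) with h | h | h
    · have : (n + 1) * D ≤ T / D * D := Nat.mul_le_mul_right _ h
      have h3 : (n + 1) * D = n * D + D := by ring
      have h4 : T / D * D = D * (T / D) := by ring
      exact iff_of_true (by omega) (Or.inl h)
    · have h4 : n * D = D * (T / D) := by rw [h]; ring
      omega
    · have : (T / D + 1) * D ≤ n * D := Nat.mul_le_mul_right _ h
      have h3 : (T / D + 1) * D = D * (T / D) + D := by ring
      exact iff_of_false (by omega) (by omega)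
  rw [key]
  constructor
  · intro h
    have h1 : T / D = k / D' := eq_of_forall_lt_iff (fun n => ?_)
    · have h2 := (h (T / D)).2
      rw [hmul hD, hmul hD', ← h1] at h2
      simp only [lt_irrefl, true_and, false_or] at h2
      exact ⟨h1, not_iff_not.1 h2⟩
    · have := (h (n + 1)).1
      omega
  · rintro ⟨h1, h2⟩ n
    rw [hmul hD, hmul hD', h1, Ne, Ne, h2]
    exact ⟨Iff.rfl, Iff.rfl⟩

/-- Integers represent themselves, and midpoints represent the open unit intervals. -/
theorem exists_sameUnit_half (t : ℝ≥0) : ∃ k : ℕ, SameUnit t (k / 2) := by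
  have h2 : (0 : ℝ≥0) < 2 := zero_lt_two
  have hf := Nat.floor_le (zero_le (a := t))
  have hf' := Nat.lt_floor_add_one t
  rcases hf.lt_or_eq with h | h
  · have a1 : (⌊t⌋₊ : ℝ≥0) < ((2 * ⌊t⌋₊ + 1 : ℕ) : ℝ≥0) / 2 := by
      rw [lt_div_iff₀ h2]; norm_cast; omega
    have a2 : ((2 * ⌊t⌋₊ + 1 : ℕ) : ℝ≥0) / 2 < ⌊t⌋₊ + 1 := by
      rw [div_lt_iff₀ h2]; norm_cast; omega
    refine ⟨2 * ⌊t⌋₊ + 1, fun n => ?_⟩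
    rcases lt_or_ge ⌊t⌋₊ n with hn | hn
    · have hn : ((⌊t⌋₊ : ℝ≥0) + 1) ≤ n := by exact_mod_cast hn
      exact ⟨iff_of_true (hf'.trans_le hn) (a2.trans_le hn),
        iff_of_false (hf'.trans_le hn).not_gt (a2.trans_le hn).not_gt⟩
    · have hn : (n : ℝ≥0) ≤ ⌊t⌋₊ := by exact_mod_cast hn
      exact ⟨iff_of_false (hn.trans_lt h).not_gt (hn.trans_lt a1).not_gt,
        iff_of_true (hn.trans_lt h) (hn.trans_lt a1)⟩
  · have : ((2 * ⌊t⌋₊ : ℕ) : ℝ≥0) / 2 = t := by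
      nth_rewrite 2 [← h]
      push_cast
      rw [mul_div_cancel_left₀ _ h2.ne']
    exact ⟨2 * ⌊t⌋₊, by rw [this]; exact fun _ => ⟨Iff.rfl, Iff.rfl⟩⟩

theorem ENTA.mem_firstTimestamp_congr {A : ENTA} {e a : ℕ} {t t' : ℝ≥0} (hA : A.BoundedBy e)
    (h : SameUnit t t') : (t, a) ∈ A.firstTimestamp ↔ (t', a) ∈ A.firstTimestamp := by
  rw [ENTA.mem_firstTimestamp_iff, ENTA.mem_firstTimestamp_iff]
  exact exists_congr fun m => ⟨fun h' => h'.of_sameUnit hA h, fun h' => h'.of_sameUnit hA h.symm⟩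

/-- The words of length `m` over the alphabet `l`. -/
def words {α : Type*} (l : List α) : ℕ → List (List α)
  | 0 => [[]]
  | m + 1 => (words l m).flatMap fun h => l.map fun x => x :: h

theorem mem_words {α : Type*} {l : List α} :
    ∀ {m : ℕ} {h : List α}, h.length = m → (∀ x ∈ h, x ∈ l) → h ∈ words l m
  | 0, [], _, _ => List.mem_singleton.2 rfl
  | _ + 1, x :: h, hl, hx => List.mem_flatMap.2 ⟨h, mem_words (Nat.succ.inj hl)
      fun y hy => hx y (List.mem_cons_of_mem _ hy),
      List.mem_map.2 ⟨x, hx x List.mem_cons_self, rfl⟩⟩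

/-- The pairs of a delay below `N` and a transition of `A`. -/
def ENTA.timedTrans (A : ENTA) (N : ℕ) : List (ℕ × Transition) :=
  (List.range N).flatMap fun d => A.trans.map fun τ => (d, τ)

theorem ENTA.mem_timedTrans {A : ENTA} {N : ℕ} {x : ℕ × Transition} :
    x ∈ A.timedTrans N ↔ x.1 < N ∧ x.2 ∈ A.trans := by
  simp [ENTA.timedTrans, Prod.ext_iff]

theorem ENTA.IsHist.mem_timedTrans {A : ENTA} {D N : ℕ} :
    ∀ {h}, A.IsHist D h → histTime h < N → ∀ x ∈ h, x ∈ A.timedTrans N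
  | [], _, _ => by simp
  | x :: h, hh, hN => by
    simp only [histTime] at hN
    intro y hy
    rcases List.mem_cons.1 hy with rfl | hy
    · exact ENTA.mem_timedTrans.2 ⟨by omega, hh.1.1.1⟩
    · exact hh.2.mem_timedTrans (by omega) y hy

/-- A bound for the number of transitions until a first event at time `k / 2`. -/
def eventBound (e k : ℕ) : ℕ :=
  (k + 1) * regionBound e

/-- The denominator of a grid that suffices for the first events at time `k / 2`. -/
def eventGrid (e k : ℕ) : ℕ :=
  eventBound e k + 3

/-- The pairs of delays and transitions to be tried for first events at time `k / 2`. -/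
def ENTA.eventAlphabet (A : ENTA) (e k : ℕ) : List (ℕ × Transition) :=
  A.timedTrans (eventGrid e k * (k + 1))

/-- The lists to be tried for first events at time `k / 2`. -/
def ENTA.eventHists (A : ENTA) (e k : ℕ) : List (List (ℕ × Transition)) :=
  (List.range (eventBound e k)).flatMap (words (A.eventAlphabet e k))

theorem ENTA.half_mem_firstTimestamp_iff {A : ENTA} {e : ℕ} (hA : A.BoundedBy e) (k a : ℕ) :
    ((k / 2 : ℝ≥0), a) ∈ A.firstTimestamp ↔
      ∃ h ∈ A.eventHists e k, ∃ x ∈ A.eventAlphabet e k,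
        A.IsHist (eventGrid e k) h ∧ A.HistEnabled (eventGrid e k) h x ∧ x.2.act = some a ∧
        (histTime h + x.1) / eventGrid e k = k / 2 ∧
        ((histTime h + x.1) % eventGrid e k = 0 ↔ k % 2 = 0) := by
  have hD : 0 < eventGrid e k := Nat.succ_pos _
  have hunit := sameUnit_natCast_div_iff hD two_pos
  constructor
  · intro hk
    obtain ⟨m, hm⟩ := ENTA.mem_firstTimestamp_iff.1 hk
    obtain ⟨m', hm', t', ht, h'⟩ := hm.exists_lt_bound hA
    have hfl : ⌊(k / 2 : ℝ≥0)⌋₊ = k / 2 := by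
      have := Nat.floor_div_natCast (k : ℝ≥0) 2
      simpa using this
    have hm'' : m' < eventBound e k := by
      rw [hfl] at hm'
      exact hm'.trans_le (Nat.mul_le_mul_right _ (by omega))
    obtain ⟨h, x, h1, h2, h3, h4, h5⟩ :=
      h'.exists_isHist (D := eventGrid e k) (by unfold eventGrid; omega)
    have h6 := (hunit (histTime h + x.1) k).1 (by simpa using (ht.trans h5).symm)
    -- The total time in grid units bounds every single delay, so the finite alphabet contains all
    -- the pairs used.
    have hlt : histTime h + x.1 < eventGrid e k * (k + 1) := by
      rw [mul_comm, ← Nat.div_lt_iff_lt_mul hD]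
      omega
    refine ⟨h, List.mem_flatMap.2 ⟨m', List.mem_range.2 hm'', mem_words h2
      (h1.mem_timedTrans (by omega))⟩, x, ENTA.mem_timedTrans.2 ⟨by omega, h3.1⟩, h1, h3, h4, h6⟩
  · rintro ⟨h, -, x, -, h1, h2, h3, h4⟩
    have h5 := (hunit _ k).2 h4
    rw [Nat.cast_ofNat] at h5
    exact (ENTA.mem_firstTimestamp_congr hA h5).1
      (ENTA.mem_firstTimestamp_iff.2 ⟨_, h1.observes hD h2 h3⟩)

theorem ENTA.mem_actions_of_mem_firstTimestamp {A : ENTA} {t : ℝ≥0} {a : ℕ}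
    (h : (t, a) ∈ A.firstTimestamp) : a ∈ A.actions := by
  obtain ⟨m, τ, v, _, h2, h3, _⟩ := ENTA.mem_firstTimestamp_iff.1 h
  exact A.act_mem τ h2 a h3

/-! ### Codes bound the entries -/

theorem encode_le_encode_of_mem {α : Type*} [Encodable α] {a : α} :
    ∀ {l : List α}, a ∈ l → Encodable.encode a ≤ Encodable.encode l
  | b :: l, h => by
    rw [Encodable.encode_list_cons]
    rcases List.mem_cons.1 h with rfl | h
    · exact (Nat.left_le_pair _ _).trans (Nat.le_succ _)
    · exact ((encode_le_encode_of_mem h).trans (Nat.right_le_pair _ _)).trans (Nat.le_succ _)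

theorem encode_fst_le {α β : Type*} [Encodable α] [Encodable β] (x : α × β) :
    Encodable.encode x.1 ≤ Encodable.encode x :=
  Nat.left_le_pair _ _

theorem encode_snd_le {α β : Type*} [Encodable α] [Encodable β] (x : α × β) :
    Encodable.encode x.2 ≤ Encodable.encode x :=
  Nat.right_le_pair _ _

/-- The tuple of the components of an automaton. -/
def ENTA.toRaw (A : ENTA) : RawENTA :=
  (A.locs, A.init, A.actions, A.clocks, A.trans)

theorem ENTA.encode_toRaw (A : ENTA) : Encodable.encode A.toRaw = Encodable.encode A :=
  rfl

theorem Transition.encode_equivProd (τ : Transition) :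
    Encodable.encode (Transition.equivProd τ) = Encodable.encode τ :=
  rfl

theorem Constraint.encode_equivProd (k : Constraint) :
    Encodable.encode (Constraint.equivProd k) = Encodable.encode k :=
  rfl

/-- Pairing dominates both of its arguments, so the code of `A` exceeds every number occurring in
`A`. This gives a computable, if wasteful, bound `e`. -/
theorem ENTA.boundedBy_encode (A : ENTA) : A.BoundedBy (Encodable.encode A) := by
  have htr : ∀ τ ∈ A.trans, Encodable.encode τ ≤ Encodable.encode A := fun τ hτ =>
    (encode_le_encode_of_mem hτ).trans <| A.encode_toRaw ▸
      (encode_snd_le A.toRaw.2.2.2).trans ((encode_snd_le A.toRaw.2.2).trans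
        ((encode_snd_le A.toRaw.2).trans (encode_snd_le A.toRaw)))
  refine ⟨?_, fun τ hτ => le_trans ?_ (htr τ hτ), fun τ hτ k hk => ?_⟩
  · exact A.encode_toRaw ▸ (encode_fst_le A.toRaw.2).trans (encode_snd_le A.toRaw)
  · rw [← τ.encode_equivProd]
    exact (encode_snd_le τ.equivProd.2.2.2).trans ((encode_snd_le τ.equivProd.2.2).trans
      ((encode_snd_le τ.equivProd.2).trans (encode_snd_le τ.equivProd)))
  · have hk' : Encodable.encode k ≤ Encodable.encode A := by
      refine le_trans ?_ (htr τ hτ)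
      rw [← τ.encode_equivProd]
      exact (encode_le_encode_of_mem hk).trans ((encode_fst_le τ.equivProd.2.2).trans
        ((encode_snd_le τ.equivProd.2).trans (encode_snd_le τ.equivProd)))
    rw [← k.encode_equivProd] at hk'
    exact ⟨(encode_fst_le k.equivProd).trans hk', ((encode_snd_le k.equivProd.2).trans
      (encode_snd_le k.equivProd)).trans hk'⟩


/-! ### Primitive recursive constructions -/

theorem primrec_nat_pow : Primrec₂ fun m n : ℕ => m ^ n :=
  Primrec₂.unpaired'.1 Nat.Primrec.pow

theorem primrec_factorial : Primrec Nat.factorial :=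
  (Primrec.nat_rec₁ (f := fun n r : ℕ => (n + 1) * r) 1
    (Primrec.nat_mul.comp (Primrec.succ.comp Primrec.fst) Primrec.snd)).of_eq fun n => by
      induction n with
      | zero => rfl
      | succ n ih => rw [Nat.factorial_succ, ← ih]

theorem primrecPred_iff {α : Type*} [Primcodable α] {p q : α → Prop} (hp : PrimrecPred p)
    (hq : PrimrecPred q) : PrimrecPred fun a => (p a ↔ q a) :=
  ((hp.and hq).or (hp.not.and hq.not)).of_eq fun a => by tauto

theorem primrecPred_imp {α : Type*} [Primcodable α] {p q : α → Prop} (hp : PrimrecPred p)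
    (hq : PrimrecPred q) : PrimrecPred fun a => (p a → q a) :=
  (hp.not.or hq).of_eq fun a => by tauto

theorem primrec_regionBound : Primrec regionBound := by
  have h1 : Primrec fun e : ℕ => e + 1 := Primrec.succ
  have h3 : Primrec fun e : ℕ => e + 3 := Primrec.nat_add.comp Primrec.id (Primrec.const 3)
  have h4 : Primrec fun e : ℕ => 2 * e + 4 :=
    Primrec.nat_add.comp (Primrec.nat_mul.comp (Primrec.const 2) Primrec.id) (Primrec.const 4)
  exact Primrec.nat_mul.comp h1 (primrec_nat_pow.comp
    (primrec_nat_pow.comp (primrec_nat_pow.comp (Primrec.const 2) h4) h3) h3)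

theorem primrec_periodBound : Primrec periodBound :=
  primrec_nat_pow.comp (Primrec.const 2) primrec_regionBound

theorem primrec_eventBound : Primrec₂ eventBound :=
  Primrec.nat_mul.comp (Primrec.succ.comp Primrec.snd) (primrec_regionBound.comp Primrec.fst)

theorem primrec_eventGrid : Primrec₂ eventGrid :=
  Primrec.nat_add.comp (primrec_eventBound.comp Primrec.fst Primrec.snd) (Primrec.const 3)

theorem primrec_words {α : Type*} [Primcodable α] : Primrec₂ (words (α := α)) := by
  have : Primrec₂ fun (p : List α × ℕ) (q : ℕ × List (List α)) =>
      q.2.flatMap fun h => p.1.map fun x => x :: h := by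
    refine Primrec.list_flatMap (Primrec.snd.comp Primrec.snd) ?_
    refine Primrec.list_map (Primrec.fst.comp (Primrec.fst.comp Primrec.fst)) ?_
    exact Primrec.list_cons.comp Primrec.snd (Primrec.snd.comp Primrec.fst)
  refine (Primrec.nat_rec' Primrec.snd (Primrec.const [[]]) this).of_eq ?_
  rintro ⟨l, m⟩
  induction m with
  | zero => rfl
  | succ m ih => exact congrArg (List.flatMap _) ih

theorem primrec_toRaw : Primrec ENTA.toRaw :=
  Primrec.subtype_val.comp (Primrec.of_equiv (e := ENTA.equivSubtype))

theorem primrec_init : Primrec ENTA.init :=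
  (Primrec.fst.comp Primrec.snd).comp primrec_toRaw

theorem primrec_actions : Primrec ENTA.actions :=
  (Primrec.fst.comp (Primrec.snd.comp Primrec.snd)).comp primrec_toRaw

theorem primrec_trans : Primrec ENTA.trans :=
  (Primrec.snd.comp (Primrec.snd.comp (Primrec.snd.comp Primrec.snd))).comp primrec_toRaw

theorem primrec_src : Primrec Transition.src :=
  Primrec.fst.comp primrec_transition_equiv

theorem primrec_act : Primrec Transition.act :=
  (Primrec.fst.comp Primrec.snd).comp primrec_transition_equiv

theorem primrec_guard : Primrec Transition.guard :=
  (Primrec.fst.comp (Primrec.snd.comp Primrec.snd)).comp primrec_transition_equiv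

theorem primrec_reset : Primrec Transition.reset :=
  (Primrec.fst.comp (Primrec.snd.comp (Primrec.snd.comp Primrec.snd))).comp
    primrec_transition_equiv

theorem primrec_tgt : Primrec Transition.tgt :=
  (Primrec.snd.comp (Primrec.snd.comp (Primrec.snd.comp Primrec.snd))).comp
    primrec_transition_equiv

theorem primrec_constraint_equiv : Primrec Constraint.equivProd :=
  Primrec.of_equiv (e := Constraint.equivProd)

theorem primrec_cmp : Primrec Constraint.cmp :=
  (Primrec.fst.comp Primrec.snd).comp primrec_constraint_equiv

theorem primrec_bound : Primrec Constraint.bound :=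
  (Primrec.snd.comp Primrec.snd).comp primrec_constraint_equiv

theorem primrecPred_holds : PrimrecPred fun p : Cmp × ℕ × ℕ => p.1.Holds p.2.1 p.2.2 := by
  have hc (c : Cmp) : PrimrecPred fun p : Cmp × ℕ × ℕ => p.1 = c :=
    Primrec.eq.comp Primrec.fst (Primrec.const c)
  have hx : Primrec fun p : Cmp × ℕ × ℕ => p.2.1 := Primrec.fst.comp Primrec.snd
  have hy : Primrec fun p : Cmp × ℕ × ℕ => p.2.2 := Primrec.snd.comp Primrec.snd
  refine (((hc .lt).and (Primrec.nat_lt.comp hx hy)).or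
    (((hc .le).and (Primrec.nat_le.comp hx hy)).or
    (((hc .eq).and (Primrec.eq.comp hx hy)).or
    (((hc .ge).and (Primrec.nat_le.comp hy hx)).or
    ((hc .gt).and (Primrec.nat_lt.comp hy hx)))))).of_eq ?_
  rintro ⟨c, x, y⟩
  cases c <;> simp [Cmp.Holds]

theorem primrec_histTime : Primrec histTime := by
  have : Primrec₂ fun (_ : List (ℕ × Transition))
      (q : (ℕ × Transition) × List (ℕ × Transition) × ℕ) => q.1.1 + q.2.2 :=
    Primrec.nat_add.comp (Primrec.fst.comp (Primrec.fst.comp Primrec.snd))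
      (Primrec.snd.comp (Primrec.snd.comp Primrec.snd))
  refine (Primrec.list_rec Primrec.id (Primrec.const 0) this).of_eq fun h => ?_
  induction h with
  | nil => rfl
  | cons x h ih => exact congrArg (x.1 + ·) ih

theorem primrec_histClock : Primrec₂ histClock := by
  have : Primrec₂ fun (p : ℕ × List (ℕ × Transition))
      (q : (ℕ × Transition) × List (ℕ × Transition) × ℕ) =>
      if p.1 ∈ q.1.2.reset then 0 else q.1.1 + q.2.2 := by
    refine Primrec.ite ?_ (Primrec.const 0) ?_
    · exact primrecRel_mem.comp (Primrec.fst.comp Primrec.fst)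
        (primrec_reset.comp (Primrec.snd.comp (Primrec.fst.comp Primrec.snd)))
    · exact Primrec.nat_add.comp (Primrec.fst.comp (Primrec.fst.comp Primrec.snd))
        (Primrec.snd.comp (Primrec.snd.comp Primrec.snd))
  refine (Primrec.list_rec Primrec.snd (Primrec.const 0) this).of_eq ?_
  rintro ⟨c, h⟩
  induction h with
  | nil => rfl
  | cons x h ih => exact congrArg (fun y => if c ∈ x.2.reset then 0 else x.1 + y) ih

theorem primrec_histLoc : Primrec₂ histLoc := by
  have : Primrec₂ fun (_ : ℕ × List (ℕ × Transition))
      (q : (ℕ × Transition) × List (ℕ × Transition)) => q.1.2.tgt :=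
    primrec_tgt.comp (Primrec.snd.comp (Primrec.fst.comp Primrec.snd))
  refine (Primrec.list_casesOn Primrec.snd Primrec.fst this).of_eq ?_
  rintro ⟨q, _ | ⟨x, h⟩⟩ <;> rfl

theorem primrecRel_histEnabled :
    PrimrecRel fun (x : ℕ × Transition) (p : (ENTA × ℕ) × List (ℕ × Transition)) =>
      p.1.1.HistEnabled p.1.2 p.2 x := by
  have hτ : Primrec fun y : (ℕ × Transition) × (ENTA × ℕ) × List (ℕ × Transition) => y.1.2 :=
    Primrec.snd.comp Primrec.fst
  have hA : Primrec fun y : (ℕ × Transition) × (ENTA × ℕ) × List (ℕ × Transition) => y.2.1.1 :=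
    Primrec.fst.comp (Primrec.fst.comp Primrec.snd)
  have hh : Primrec fun y : (ℕ × Transition) × (ENTA × ℕ) × List (ℕ × Transition) => y.2.2 :=
    Primrec.snd.comp Primrec.snd
  have h1 : PrimrecPred fun y : (ℕ × Transition) × (ENTA × ℕ) × List (ℕ × Transition) =>
      y.1.2 ∈ y.2.1.1.trans :=
    ((PrimrecRel.exists_mem_list (R := fun σ τ : Transition => σ = τ) Primrec.eq).comp
      (primrec_trans.comp hA) hτ).of_eq fun y => by simp
  have h2 : PrimrecPred fun y : (ℕ × Transition) × (ENTA × ℕ) × List (ℕ × Transition) =>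
      y.1.2.src = histLoc y.2.1.1.init y.2.2 :=
    Primrec.eq.comp (primrec_src.comp hτ) (primrec_histLoc.comp (primrec_init.comp hA) hh)
  refine h1.and (h2.and (primrecPred_forall_mem
    (r := fun (k : Constraint) (y : (ℕ × Transition) × (ENTA × ℕ) × List (ℕ × Transition)) =>
      k.cmp.Holds (y.1.1 + histClock k.clock y.2.2 : ℕ) (k.bound * y.2.1.2 : ℕ))
    (primrec_guard.comp hτ) ?_))
  refine primrecPred_holds.comp (f := fun z : Constraint × (ℕ × Transition) × (ENTA × ℕ) ×
    List (ℕ × Transition) => (z.1.cmp, z.2.1.1 + histClock z.1.clock z.2.2.2,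
      z.1.bound * z.2.2.1.2)) ?_
  refine (primrec_cmp.comp Primrec.fst).pair (Primrec.pair ?_ ?_)
  · exact Primrec.nat_add.comp (Primrec.fst.comp (Primrec.fst.comp Primrec.snd))
      (primrec_histClock.comp (primrec_constraint_clock.comp Primrec.fst) (hh.comp Primrec.snd))
  · exact Primrec.nat_mul.comp (primrec_bound.comp Primrec.fst)
      (Primrec.snd.comp (Primrec.fst.comp (Primrec.snd.comp Primrec.snd)))

/-- Validity is computed as a Boolean by recursion on the list; the tail available in each step is
the history in which the head must be enabled. -/
theorem primrecRel_isHist :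
    PrimrecRel fun (h : List (ℕ × Transition)) (p : ENTA × ℕ) => p.1.IsHist p.2 h := by
  classical
  have hstep : PrimrecPred fun y : (List (ℕ × Transition) × ENTA × ℕ) ×
      ((ℕ × Transition) × List (ℕ × Transition) × Bool) =>
      (y.1.2.1.HistEnabled y.1.2.2 y.2.2.1 y.2.1 ∧ y.2.1.2.act = none) ∧ y.2.2.2 = true := by
    refine PrimrecPred.and (PrimrecPred.and ?_ ?_) ?_
    · exact primrecRel_histEnabled.comp (Primrec.fst.comp Primrec.snd)
        (Primrec.pair (Primrec.snd.comp Primrec.fst)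
          (Primrec.fst.comp (Primrec.snd.comp Primrec.snd)))
    · exact Primrec.eq.comp (primrec_act.comp (Primrec.snd.comp (Primrec.fst.comp Primrec.snd)))
        (Primrec.const none)
    · exact Primrec.eq.comp (Primrec.snd.comp (Primrec.snd.comp Primrec.snd))
        (Primrec.const true)
  have hrec := Primrec.list_rec (f := fun p : List (ℕ × Transition) × ENTA × ℕ => p.1)
    Primrec.fst (Primrec.const true) (primrecPred_iff_primrec_decide.1 hstep).to₂
  refine (Primrec.eq.comp hrec (Primrec.const true)).of_eq ?_
  rintro ⟨h, A, D⟩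
  induction h with
  | nil => exact iff_of_true rfl trivial
  | cons x h ih =>
    simp only [decide_eq_true_eq] at ih ⊢
    exact and_congr_right fun _ => ih

theorem primrec_timedTrans : Primrec₂ ENTA.timedTrans := by
  refine Primrec.list_flatMap (Primrec.list_range.comp Primrec.snd) ?_
  refine Primrec.list_map (primrec_trans.comp (Primrec.fst.comp Primrec.fst)) ?_
  exact Primrec.pair (Primrec.snd.comp Primrec.fst) Primrec.snd

theorem primrecPred_half_mem_firstTimestamp : PrimrecPred fun p : ENTA × ℕ × ℕ =>
    ((p.2.1 / 2 : ℝ≥0), p.2.2) ∈ p.1.firstTimestamp := by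
  have hA : Primrec fun p : ENTA × ℕ × ℕ => p.1 := Primrec.fst
  have hk : Primrec fun p : ENTA × ℕ × ℕ => p.2.1 := Primrec.fst.comp Primrec.snd
  have ha : Primrec fun p : ENTA × ℕ × ℕ => p.2.2 := Primrec.snd.comp Primrec.snd
  have he : Primrec fun p : ENTA × ℕ × ℕ => Encodable.encode p.1 := Primrec.encode.comp hA
  have hD : Primrec fun p : ENTA × ℕ × ℕ => eventGrid (Encodable.encode p.1) p.2.1 :=
    primrec_eventGrid.comp he hk
  have hAl : Primrec fun p : ENTA × ℕ × ℕ => p.1.eventAlphabet (Encodable.encode p.1) p.2.1 :=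
    primrec_timedTrans.comp hA (Primrec.nat_mul.comp hD (Primrec.succ.comp hk))
  have hH : Primrec fun p : ENTA × ℕ × ℕ => p.1.eventHists (Encodable.encode p.1) p.2.1 :=
    Primrec.list_flatMap (Primrec.list_range.comp (primrec_eventBound.comp he hk))
      (primrec_words.comp (hAl.comp Primrec.fst) Primrec.snd)
  have hq : Primrec fun z : (ℕ × Transition) × List (ℕ × Transition) × ENTA × ℕ × ℕ => z.2.2 :=
    Primrec.snd.comp Primrec.snd
  have hh : Primrec fun z : (ℕ × Transition) × List (ℕ × Transition) × ENTA × ℕ × ℕ => z.2.1 :=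
    Primrec.fst.comp Primrec.snd
  have hAD : Primrec fun z : (ℕ × Transition) × List (ℕ × Transition) × ENTA × ℕ × ℕ =>
      (z.2.2.1, eventGrid (Encodable.encode z.2.2.1) z.2.2.2.1) :=
    (hA.comp hq).pair (hD.comp hq)
  have hT : Primrec fun z : (ℕ × Transition) × List (ℕ × Transition) × ENTA × ℕ × ℕ =>
      histTime z.2.1 + z.1.1 :=
    Primrec.nat_add.comp (primrec_histTime.comp hh) (Primrec.fst.comp Primrec.fst)
  have hx : PrimrecRel fun (x : ℕ × Transition) (y : List (ℕ × Transition) × ENTA × ℕ × ℕ) =>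
      y.2.1.IsHist (eventGrid (Encodable.encode y.2.1) y.2.2.1) y.1 ∧
      y.2.1.HistEnabled (eventGrid (Encodable.encode y.2.1) y.2.2.1) y.1 x ∧
      x.2.act = some y.2.2.2 ∧
      (histTime y.1 + x.1) / eventGrid (Encodable.encode y.2.1) y.2.2.1 = y.2.2.1 / 2 ∧
      ((histTime y.1 + x.1) % eventGrid (Encodable.encode y.2.1) y.2.2.1 = 0 ↔
        y.2.2.1 % 2 = 0) := by
    refine PrimrecPred.and ?_ (PrimrecPred.and ?_ (PrimrecPred.and ?_ (PrimrecPred.and ?_ ?_)))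
    · exact primrecRel_isHist.comp hh hAD
    · exact primrecRel_histEnabled.comp Primrec.fst (hAD.pair hh)
    · exact Primrec.eq.comp (primrec_act.comp (Primrec.snd.comp Primrec.fst))
        (Primrec.option_some.comp (ha.comp hq))
    · exact Primrec.eq.comp (Primrec.nat_div.comp hT (hD.comp hq))
        (Primrec.nat_div.comp (hk.comp hq) (Primrec.const 2))
    · exact primrecPred_iff
        (Primrec.eq.comp (Primrec.nat_mod.comp hT (hD.comp hq)) (Primrec.const 0))
        (Primrec.eq.comp (Primrec.nat_mod.comp (hk.comp hq) (Primrec.const 2)) (Primrec.const 0))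
  have hex : PrimrecRel fun (h : List (ℕ × Transition)) (p : ENTA × ℕ × ℕ) =>
      ∃ x ∈ p.1.eventAlphabet (Encodable.encode p.1) p.2.1,
        p.1.IsHist (eventGrid (Encodable.encode p.1) p.2.1) h ∧
        p.1.HistEnabled (eventGrid (Encodable.encode p.1) p.2.1) h x ∧ x.2.act = some p.2.2 ∧
        (histTime h + x.1) / eventGrid (Encodable.encode p.1) p.2.1 = p.2.1 / 2 ∧
        ((histTime h + x.1) % eventGrid (Encodable.encode p.1) p.2.1 = 0 ↔ p.2.1 % 2 = 0) :=
    (PrimrecRel.exists_mem_list hx).comp (hAl.comp Primrec.snd) Primrec.id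
  -- Both existential quantifiers range over computed finite lists, so membership is decided by
  -- search.
  exact ((PrimrecRel.exists_mem_list hex).comp hH Primrec.id).of_eq fun p =>
    (ENTA.half_mem_firstTimestamp_iff p.1.boundedBy_encode p.2.1 p.2.2).symm

/-! ### Decidability of inclusion -/

/-- A time beyond which all first-event timestamps of `A` repeat with period `A.period`. -/
def ENTA.periodStart (A : ENTA) : ℕ :=
  periodBound (Encodable.encode A)

/-- A period of the first-event timestamps of `A`. -/
def ENTA.period (A : ENTA) : ℕ :=
  (periodBound (Encodable.encode A)).factorial

theorem ENTA.isPeriodic (A : ENTA) : A.IsPeriodic A.periodStart A.period :=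
  A.boundedBy_encode.isPeriodic

theorem primrec_periodStart : Primrec ENTA.periodStart :=
  primrec_periodBound.comp Primrec.encode

theorem primrec_period : Primrec ENTA.period :=
  primrec_factorial.comp primrec_periodStart

/-- Both sets of first events are unions of unit classes, and each class below `N` has a
representative `k / 2` with `k < 2 * N`. -/
theorem ENTA.firstTimestamp_subset_of_half {A₁ A₂ : ENTA} {N : ℕ}
    (h : ∀ k < 2 * N, ∀ a ∈ A₁.actions, ((k / 2 : ℝ≥0), a) ∈ A₁.firstTimestamp →
      ((k / 2 : ℝ≥0), a) ∈ A₂.firstTimestamp) {t : ℝ≥0} {a : ℕ} (ht : t < N)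
    (hta : (t, a) ∈ A₁.firstTimestamp) : (t, a) ∈ A₂.firstTimestamp := by
  obtain ⟨k, hk⟩ := exists_sameUnit_half t
  have hkN : k < 2 * N := by
    have := (hk N).1.1 ht
    rw [div_lt_iff₀ zero_lt_two, mul_comm] at this
    exact_mod_cast this
  rw [ENTA.mem_firstTimestamp_congr A₂.boundedBy_encode hk]
  rw [ENTA.mem_firstTimestamp_congr A₁.boundedBy_encode hk] at hta
  exact h k hkN a (ENTA.mem_actions_of_mem_firstTimestamp hta) hta

/-- A time up to which the first-event timestamps of two automata have to be compared. -/
def comparisonTime (A₁ A₂ : ENTA) : ℕ :=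
  max A₁.periodStart A₂.periodStart + A₁.period * A₂.period

theorem primrec_comparisonTime : Primrec₂ comparisonTime :=
  Primrec.nat_add.comp
    (Primrec.nat_max.comp (primrec_periodStart.comp Primrec.fst)
      (primrec_periodStart.comp Primrec.snd))
    (Primrec.nat_mul.comp (primrec_period.comp Primrec.fst) (primrec_period.comp Primrec.snd))

theorem ENTA.firstTimestamp_subset_iff_half (A₁ A₂ : ENTA) :
    A₁.firstTimestamp ⊆ A₂.firstTimestamp ↔
      ∀ k < 2 * comparisonTime A₁ A₂, ∀ a ∈ A₁.actions,
        ((k / 2 : ℝ≥0), a) ∈ A₁.firstTimestamp → ((k / 2 : ℝ≥0), a) ∈ A₂.firstTimestamp := by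
  refine ⟨fun h k _ a _ hk => h hk, fun h => ?_⟩
  rw [ENTA.firstTimestamp_subset_iff A₁.isPeriodic A₂.isPeriodic]
  intro t a ht hta
  refine ENTA.firstTimestamp_subset_of_half h (ht.trans_le ?_) hta
  -- Any comparison time beyond the one with the least common multiple will do; the product of the
  -- periods is such a bound.
  exact_mod_cast Nat.add_le_add_left (Nat.le_of_dvd
    (Nat.mul_pos A₁.isPeriodic.2.1 A₂.isPeriodic.2.1) (Nat.lcm_dvd_mul _ _)) _

theorem primrecPred_firstTimestamp_subset : PrimrecPred fun p : ENTA × ENTA =>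
    p.1.firstTimestamp ⊆ p.2.firstTimestamp := by
  have h1 : PrimrecRel fun (a : ℕ) (y : ℕ × ENTA × ENTA) =>
      ((y.1 / 2 : ℝ≥0), a) ∈ y.2.1.firstTimestamp → ((y.1 / 2 : ℝ≥0), a) ∈ y.2.2.firstTimestamp :=
    primrecPred_imp
      (primrecPred_half_mem_firstTimestamp.comp (f := fun z : ℕ × ℕ × ENTA × ENTA =>
          (z.2.2.1, z.2.1, z.1))
        (Primrec.pair (Primrec.fst.comp (Primrec.snd.comp Primrec.snd))
          (Primrec.pair (Primrec.fst.comp Primrec.snd) Primrec.fst)))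
      (primrecPred_half_mem_firstTimestamp.comp (f := fun z : ℕ × ℕ × ENTA × ENTA =>
          (z.2.2.2, z.2.1, z.1))
        (Primrec.pair (Primrec.snd.comp (Primrec.snd.comp Primrec.snd))
          (Primrec.pair (Primrec.fst.comp Primrec.snd) Primrec.fst)))
  have h2 : PrimrecRel fun (k : ℕ) (p : ENTA × ENTA) => ∀ a ∈ p.1.actions,
      ((k / 2 : ℝ≥0), a) ∈ p.1.firstTimestamp → ((k / 2 : ℝ≥0), a) ∈ p.2.firstTimestamp :=
    primrecPred_forall_mem (primrec_actions.comp (Primrec.fst.comp Primrec.snd)) h1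
  have h3 : Primrec fun p : ENTA × ENTA => List.range (2 * comparisonTime p.1 p.2) :=
    Primrec.list_range.comp
      (Primrec.nat_mul.comp (Primrec.const 2)
        (primrec_comparisonTime.comp Primrec.fst Primrec.snd))
  exact (primrecPred_forall_mem h3 h2).of_eq fun p => by
    simp only [List.mem_range]
    exact (ENTA.firstTimestamp_subset_iff_half p.1 p.2).symm

end TimedAutomata

theorem mainTheorem5 :
    -- period parameters of the first-event timestamp can be computed from the automaton
    (∃ tper L : TimedAutomata.ENTA → ℕ, Computable tper ∧ Computable L ∧
      ∀ A : TimedAutomata.ENTA, A.IsPeriodic (tper A) (L A)) ∧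
    -- comparing the first-event timestamps up to time `tper + L`, for a common period, suffices
    (∀ (A₁ A₂ : TimedAutomata.ENTA) (tper₁ L₁ tper₂ L₂ : ℕ),
      A₁.IsPeriodic tper₁ L₁ → A₂.IsPeriodic tper₂ L₂ →
        (A₁.boundedLanguage 1 ⊆ A₂.boundedLanguage 1 ↔
          ∀ (t : NNReal) (a : ℕ), t < ((max tper₁ tper₂ + Nat.lcm L₁ L₂ : ℕ) : NNReal) →
            (t, a) ∈ A₁.firstTimestamp → (t, a) ∈ A₂.firstTimestamp)) ∧
    -- the 1-bounded language inclusion problem is decidable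
    ComputablePred (fun p : TimedAutomata.ENTA × TimedAutomata.ENTA =>
      p.1.boundedLanguage 1 ⊆ p.2.boundedLanguage 1) := by
  open TimedAutomata in
  refine ⟨⟨ENTA.periodStart, ENTA.period, primrec_periodStart.to_comp, primrec_period.to_comp,
    ENTA.isPeriodic⟩, fun A₁ A₂ p₁ L₁ p₂ L₂ h₁ h₂ => ?_, ?_⟩
  · exact ENTA.boundedLanguage_one_subset_iff.trans (ENTA.firstTimestamp_subset_iff h₁ h₂)
  · exact primrecPred_firstTimestamp_subset.computablePred.of_eq fun p =>
      ENTA.boundedLanguage_one_subset_iff.symm
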